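/- **Theorem 5.1.** Let $k$ be a field with $\operatorname{char} k\neq 2,3$, let $M\supset k$ be an infinite field and $\overline M$ an algebraic closure of $M$. For $a\in M$ let $f_a(X)=X^3+aX+a$, let $L_a\subset\overline M$ be the splitting field of $f_a$ over $M$, and let $G_a=\mathrm{Gal}(f_a/M)$; for $a,b\in M$ let $G_{a,b}=\mathrm{Gal}(f_af_b/M)$ and $$F_{a,b}(X)=a(X^2+9X-3a)^3-b(X^3-2aX^2-9aX-2a^2-27a)^2 .$$ For a separable polynomial $f\in M[X]$, the decomposition type $\mathrm{DT}(f)$ over $M$ is the partition of $\deg f$ given by the degrees of the irreducible factors of $f$ in $M[X]$. Let $a,b\in M$ with $a\neq b$, $ab(4a+27)(4b+27)\neq 0$ and $\#G_a\geq \#G_b>1$. Then $F_{a,b}$ is separable, and the pair $(G_a,G_b)$ is, up to isomorphism, one of $(S_3,S_3)$, $(S_3,C_3)$, $(S_3,C_2)$, $(C_3,C_3)$, $(C_3,C_2)$, $(C_2,C_2)$. Given $G_a$ and $G_b$, the decomposition type $\mathrm{DT}(F_{a,b})$ determines $G_{a,b}$ up to isomorphism and answers the field intersection problem for $L_a$ and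 $L_b$ according to the following table: for each pair $(G_a,G_b)$ the only possible values of $\mathrm{DT}(F_{a,b})$ are those listed for that pair, and in each row belonging to that pair the statements about $\mathrm{DT}(F_{a,b})$, about $G_{a,b}$ and about $L_a,L_b$ are equivalent to each other (in particular all of them hold when the pair has only one row). $$\begin{array}{|c|c|c|l|l|}\hline G_a & G_b & G_{a,b} & \text{fields} & \mathrm{DT}(F_{a,b})\\ \hline S_3 & S_3 & S_3\times S_3 & L_a\cap L_b=M & 6\\ S_3 & S_3 & (C_3\times C_3)\rtimes C_2 & [L_a\cap L_b:M]=2 & 3,3\\ S_3 & S_3 & S_3 & L_a=L_b & 3,2,1\\ \hline S_3 & C_3 & S_3\times C_3 & L_a\cap L_b=M & 6\\ \hline S_3 & C_2 & D_6 & L_a\not\supset L_b\ \ (\text{equivalently } L_a\cap L_b=M) & 6\\ S_3 & C_2 & S_3 & L_a\supset L_b & 3,3\\ \hline C_3 & C_3 & C_3\times C_3 & L_a\neq L_b\ \ (\text{equivalently } L_a\cap L_b=M) & 3,3\\ C_3 & C_3 & C_3 & L_a=L_b & 3,1,1,1\\ \hline C_3 & C_2 & C_6 & L_a\cap L_b=M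 & 6\\ \hline C_2 & C_2 & C_2\times C_2 & L_a\neq L_b\ \ (\text{equivalently } L_a\cap L_b=M) & 4,2\\ C_2 & C_2 & C_2 & L_a=L_b & 2,2,1,1\\ \hline \end{array}$$ Here $D_6$ is the dihedral group of order $12$, and in $(C_3\times C_3)\rtimes C_2$ the nontrivial element of $C_2$ acts on $C_3\times C_3$ by inversion. -/

import Mathlib

open Polynomial

namespace CubicIntersection

noncomputable section

/-- The generic cubic `X³ + sX + s` for `S₃`, specialised at `s = a`. -/
def cubic {M : Type*} [Field M] (a : M) : M[X] :=
  X ^ 3 + C a * X + C a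

/-- The sextic
`F_{a,b}(X) = a (X² + 9X - 3a)³ - b (X³ - 2aX² - 9aX - 2a² - 27a)²`. -/
def sextic {M : Type*} [Field M] (a b : M) : M[X] :=
  C a * (X ^ 2 + 9 * X - C (3 * a)) ^ 3
    - C b * (X ^ 3 - C (2 * a) * X ^ 2 - C (9 * a) * X - C (2 * a ^ 2 + 27 * a)) ^ 2

/-- The splitting field of `f` over `M` inside an extension `Ω` (used for `Ω` an algebraic closure
of `M`): the subfield generated over `M` by all roots of `f` in `Ω`. -/
def splittingFieldIn {M : Type*} [Field M] (Ω : Type*) [Field Ω] [Algebra M Ω] (f : M[X]) :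
    IntermediateField M Ω :=
  IntermediateField.adjoin M (f.rootSet Ω)

/-- The decomposition type of `f` over `M`: the multiset of degrees of the irreducible factors of
`f`, a partition of the degree of `f` when `f ≠ 0`. -/
def decompositionType {M : Type*} [Field M] (f : M[X]) : Multiset ℕ :=
  (UniqueFactorizationMonoid.factors f).map natDegree

/-- The Galois group `G_a` of `X³ + aX + a` over `M`. -/
abbrev G {M : Type*} [Field M] (a : M) : Type _ := (cubic a).Gal

/-- The Galois group `G_{a,b}` of `(X³ + aX + a)(X³ + bX + b)` over `M`. -/
abbrev GPair {M : Type*} [Field M] (a b : M) : Type _ := (cubic a * cubic b).Gal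

/-- The splitting field `L_a` of `X³ + aX + a` over `M` inside `Ω`. -/
abbrev L {M : Type*} [Field M] (Ω : Type*) [Field Ω] [Algebra M Ω] (a : M) :
    IntermediateField M Ω :=
  splittingFieldIn Ω (cubic a)

/-- The decomposition type of `F_{a,b}` over `M`. -/
abbrev DT {M : Type*} [Field M] (a b : M) : Multiset ℕ := decompositionType (sextic a b)

/-- The two groups are isomorphic. -/
def Iso (G H : Type*) [Group G] [Group H] : Prop := Nonempty (G ≃* H)

/-- The cyclic group of order `n`. -/
abbrev Cyc (n : ℕ) : Type := Multiplicative (ZMod n)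

/-- The symmetric group of degree 3. -/
abbrev S3 : Type := Equiv.Perm (Fin 3)

/-- The action of the group `C₂` of order two on a commutative group in which the nontrivial
element acts by inversion. -/
def inversionAction (A : Type*) [CommGroup A] : Cyc 2 →* MulAut A where
  toFun c := if c = 1 then 1 else MulEquiv.inv A
  map_one' := if_pos rfl
  map_mul' := by
    have h : (MulEquiv.inv A : MulAut A) * MulEquiv.inv A = 1 := by
      ext x; simp [MulAut.mul_apply]
    have hc : ∀ c : Cyc 2, c ≠ 1 → ∀ d : Cyc 2, d ≠ 1 → c * d = 1 := by decide
    intro c d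
    by_cases h1 : c = 1
    · simp [h1]
    · by_cases h2 : d = 1
      · simp [h2]
      · simp [h1, h2, hc c h1 d h2, h]

/-- The group `(C₃ × C₃) ⋊ C₂` of order 18, where `C₂` acts by inversion. It is the
subgroup of `S₃ × S₃` of the pairs with equal signs. -/
abbrev C3C3C2 : Type := (Cyc 3 × Cyc 3) ⋊[inversionAction (Cyc 3 × Cyc 3)] Cyc 2

end

end CubicIntersection

open CubicIntersection

/-!
Let `θ₀, θ₁, θ₂` and `η₀, η₁, η₂` be the roots of `X³ + aX + a` and `X³ + bX + b` in `Ω`. For every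
bijection `σ` of the indices there is a unique polynomial of degree at most two carrying each `θ i`
to `η (σ i)`. Its quadratic coefficient does not vanish: an affine map between the two triples would
be the identity, because the traces vanish and each cubic has equal linear and constant
coefficients, so that `a = b`. Hence the transformation is `θ ↦ l (c θ + 3 θ²)` up to a scalar and a
translation, with a well-defined parameter `c = c_σ`. Comparing the symmetric functions of the
`η i` shows that `c_σ` is a root of `F_{a,b}` (`IsParameter.eval_sextic`). The six parameters are
distinct and `F_{a,b}` has degree six, so they are all its roots (`roots_sextic`), and `F_{a,b}` is
separable.

An automorphism of `Ω` over `M` acts on the two sets of roots by a pair `(g, h)` in `S₃ × S₃`, and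
maps `c_σ` to `c_{h σ g⁻¹}`. Let `H` be the subgroup of these pairs. It is isomorphic to the Galois
group of the product of the cubics, its projections are the two Galois groups, and the degrees of
the irreducible factors of `F_{a,b}` are the sizes of the orbits of `H` on `S₃`
(`exists_subgroup`). The relation `[L_a ∩ L_b : M] [L_a L_b : M] = [L_a : M] [L_b : M]` turns every
statement about the fields into one about the order of `H` (`fields_of_card`).

It remains to run through the subgroups `H` of `S₃ × S₃` with given nontrivial projections. In each
case the order of `H` determines its orbit sizes and its isomorphism class: `H` is the product of
its projections, or the graph of a homomorphism, or the group of pairs of equal signs (the lemmas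
`classification_S3_S3` to `classification_C2_C2`).
-/

namespace CubicIntersection

open Equiv.Perm (sign)

/-! ### Subgroups of `S₃ × S₃` and their orbits on `S₃` -/

/-- The multiset of the sizes of the orbits of `H ≤ S₃ × S₃` acting on `S₃` by
`(g, h) • σ = h σ g⁻¹`; an orbit of size `d` contributes `d` copies of `d`, one for each of its
elements. -/
noncomputable def orbitSizes (H : Subgroup (S3 × S3)) : Multiset ℕ :=
  (Finset.univ : Finset S3).val.map fun σ =>
    Nat.card {τ : S3 // ∃ x ∈ H, x.2 * σ * x.1⁻¹ = τ}

/-- The computable form of `orbitSizes` for a subgroup given by a decidable predicate: `τ` lies in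
the orbit of `σ` when `(g, τ g σ⁻¹)` lies in the subgroup for some `g`. -/
def orbitSizesOf (P : S3 → S3 → Prop) [∀ g h, Decidable (P g h)] : Multiset ℕ :=
  (Finset.univ : Finset S3).val.map fun σ =>
    (Finset.univ.filter fun τ => ∃ g, P g (τ * g * σ⁻¹)).card

theorem orbitSizes_eq {H : Subgroup (S3 × S3)} (P : S3 → S3 → Prop) [∀ g h, Decidable (P g h)]
    (hP : ∀ g h, (g, h) ∈ H ↔ P g h) : orbitSizes H = orbitSizesOf P := by
  classical
  refine Multiset.map_congr rfl fun σ _ => ?_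
  rw [Nat.card_eq_fintype_card, Fintype.card_subtype]
  congr 1
  refine Finset.filter_congr fun τ _ => ⟨?_, ?_⟩
  · rintro ⟨⟨g, h⟩, hx, rfl⟩
    exact ⟨g, by simpa using (hP _ _).1 hx⟩
  · rintro ⟨g, hg⟩
    exact ⟨_, (hP _ _).2 hg, by simp [mul_assoc]⟩

theorem card_eq_card_filter {H : Subgroup (S3 × S3)} (P : S3 → S3 → Prop)
    [∀ g h, Decidable (P g h)] (hP : ∀ g h, (g, h) ∈ H ↔ P g h) :
    Nat.card H = (Finset.univ.filter fun x : S3 × S3 => P x.1 x.2).card := by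
  classical
  rw [Nat.card_eq_fintype_card, Fintype.card_subtype]
  exact congrArg _ (Finset.filter_congr fun x _ => hP x.1 x.2)

theorem card_S3 : Nat.card S3 = 6 := by
  rw [Nat.card_eq_fintype_card]; decide

theorem eq_top_of_card {A : Subgroup S3} (h : Nat.card A = 6) : A = ⊤ :=
  Subgroup.eq_top_of_card_eq A (h.trans card_S3.symm)

theorem mem_iff_sign_of_card {A : Subgroup S3} (h : Nat.card A = 3) (g : S3) :
    g ∈ A ↔ sign g = 1 := by
  have hi : A.index = 2 := by
    have := A.card_mul_index
    rw [card_S3, h] at this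
    omega
  rw [Equiv.Perm.eq_alternatingGroup_of_index_eq_two hi, Equiv.Perm.mem_alternatingGroup]

theorem exists_involution_of_card {A : Subgroup S3} (h : Nat.card A = 2) :
    ∃ s : S3, s ≠ 1 ∧ s * s = 1 ∧ ∀ g, g ∈ A ↔ g = 1 ∨ g = s := by
  obtain ⟨s, hs⟩ : ∃ s : A, s ≠ 1 := by
    have : Nontrivial A := Finite.one_lt_card_iff_nontrivial.1 (by omega)
    exact exists_ne 1
  have hA : ∀ g ∈ A, g = 1 ∨ g = s := by
    obtain ⟨x, hx, hx'⟩ := (Nat.card_eq_two_iff' (1 : A)).1 h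
    intro g hg
    by_cases h1 : g = 1
    · exact Or.inl h1
    · have e1 := hx' ⟨g, hg⟩ (by simpa [Subtype.ext_iff] using h1)
      have e2 := hx' s hs
      exact Or.inr (congrArg Subtype.val (e1.trans e2.symm))
  have hs1 : (s : S3) ≠ 1 := by simpa using hs
  refine ⟨s, hs1, ?_, fun g => ⟨hA g, ?_⟩⟩
  · rcases hA _ (A.mul_mem s.2 s.2) with h' | h'
    · exact h'
    · exact absurd (by simpa using h') hs1
  · rintro (rfl | rfl)
    exacts [A.one_mem, s.2]

section Projections

variable {G₁ G₂ : Type*} [Group G₁] [Group G₂] {H : Subgroup (G₁ × G₂)}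

/-- A subgroup of a product as large as the product of its projections is that product. -/
theorem eq_prod_of_card [Finite G₁] [Finite G₂] (h : Nat.card H =
    Nat.card (H.map (MonoidHom.fst G₁ G₂)) * Nat.card (H.map (MonoidHom.snd G₁ G₂))) :
    H = (H.map (MonoidHom.fst G₁ G₂)).prod (H.map (MonoidHom.snd G₁ G₂)) := by
  refine Subgroup.eq_of_le_of_card_ge (Subgroup.le_prod_iff.2 ⟨le_rfl, le_rfl⟩) ?_
  rw [h, Nat.card_congr (Subgroup.prodEquiv _ _).toEquiv, Nat.card_prod]

/-- A homomorphism that does not change the order of a subgroup is injective on it. -/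
theorem eq_one_of_card_map_eq {K L : Type*} [Group K] [Group L] [Finite K] {H : Subgroup K}
    (f : K →* L) (h : Nat.card H = Nat.card (H.map f)) {x : K} (hx : x ∈ H) (h1 : f x = 1) :
    x = 1 := by
  have hb := (f.subgroupMap_surjective H).bijective_of_nat_card_le h.le
  have : (⟨x, hx⟩ : H) = 1 := hb.1 (Subtype.ext (by simpa using h1))
  exact congrArg Subtype.val this

theorem nonempty_mulEquiv_map_of_card_eq {K L : Type*} [Group K] [Group L] [Finite K]
    {H : Subgroup K} (f : K →* L) (h : Nat.card H = Nat.card (H.map f)) :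
    Nonempty (H ≃* H.map f) :=
  ⟨MulEquiv.ofBijective _ ((f.subgroupMap_surjective H).bijective_of_nat_card_le h.le)⟩

theorem card_map_dvd {K L : Type*} [Group K] [Group L] (f : K →* L) (H : Subgroup K) :
    Nat.card (H.map f) ∣ Nat.card H :=
  Subgroup.card_dvd_of_surjective _ (f.subgroupMap_surjective H)

theorem card_dvd_mul_card_map :
    Nat.card H ∣
      Nat.card (H.map (MonoidHom.fst G₁ G₂)) * Nat.card (H.map (MonoidHom.snd G₁ G₂)) := by
  rw [← Nat.card_prod, ← Nat.card_congr (Subgroup.prodEquiv _ _).toEquiv]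
  exact Subgroup.card_dvd_of_le (Subgroup.le_prod_iff.2 ⟨le_rfl, le_rfl⟩)

theorem exists_mem_snd_of_mem_map {g : G₁} (hg : g ∈ H.map (MonoidHom.fst G₁ G₂)) :
    ∃ h, (g, h) ∈ H := by
  obtain ⟨⟨g', h⟩, hx, rfl⟩ := hg
  exact ⟨h, hx⟩

theorem exists_mem_fst_of_mem_map {h : G₂} (hh : h ∈ H.map (MonoidHom.snd G₁ G₂)) :
    ∃ g, (g, h) ∈ H := by
  obtain ⟨⟨g, h'⟩, hx, rfl⟩ := hh
  exact ⟨g, hx⟩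

end Projections

-- The statements about `S₃` checked by enumeration need deep recursion.
set_option maxRecDepth 100000

section Classification

variable {H : Subgroup (S3 × S3)}

local notation "A₁" => Subgroup.map (MonoidHom.fst S3 S3)
local notation "A₂" => Subgroup.map (MonoidHom.snd S3 S3)

theorem mem_iff_of_card (h : Nat.card H = Nat.card (A₁ H) * Nat.card (A₂ H)) (g k : S3) :
    (g, k) ∈ H ↔ g ∈ A₁ H ∧ k ∈ A₂ H := by
  conv_lhs => rw [eq_prod_of_card h]
  rfl

/-- A subgroup `H` of `S₃ × S₃` with both projections onto is everything, or the pairs of equal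
signs, or the graph of an automorphism, which is inner. -/
theorem classification_S3_S3 (h1 : Nat.card (A₁ H) = 6) (h2 : Nat.card (A₂ H) = 6) :
    (Nat.card H = 36 ∧ orbitSizes H = {6, 6, 6, 6, 6, 6}) ∨
    (Nat.card H = 18 ∧ orbitSizes H = {3, 3, 3, 3, 3, 3} ∧
      ∀ g k, (g, k) ∈ H ↔ sign g = sign k) ∨
    (Nat.card H = 6 ∧ orbitSizes H = {3, 3, 3, 2, 2, 1}) := by
  have l1 : ∀ g, ∃ k, (g, k) ∈ H := fun g =>
    exists_mem_snd_of_mem_map (by rw [eq_top_of_card h1]; trivial)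
  have l2 : ∀ k, ∃ g, (g, k) ∈ H := fun k =>
    exists_mem_fst_of_mem_map (by rw [eq_top_of_card h2]; trivial)
  have c1 : ∀ g x, (g, (1 : S3)) ∈ H → (x * g * x⁻¹, (1 : S3)) ∈ H := by
    intro g x hg
    obtain ⟨y, hy⟩ := l1 x
    simpa using H.mul_mem (H.mul_mem hy hg) (H.inv_mem hy)
  by_cases hodd : ∃ g, sign g ≠ 1 ∧ (g, (1 : S3)) ∈ H
  · -- The transpositions in the first factor generate it, so `H` is everything.
    left
    obtain ⟨s, hs, hsH⟩ := hodd
    have gen : ∀ s : S3, sign s ≠ 1 → ∀ g : S3, ∃ x y, g = x * s * x⁻¹ * (y * s * y⁻¹) ∨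
        g = x * s * x⁻¹ := by decide
    have full : ∀ g, (g, (1 : S3)) ∈ H := by
      intro g
      obtain ⟨x, y, rfl | rfl⟩ := gen s hs g
      · simpa using H.mul_mem (c1 s x hsH) (c1 s y hsH)
      · exact c1 s x hsH
    have hP : ∀ g k, (g, k) ∈ H ↔ True := by
      intro g k
      obtain ⟨x, hx⟩ := l2 k
      simpa using H.mul_mem (full (g * x⁻¹)) hx
    rw [orbitSizes_eq _ hP, card_eq_card_filter _ hP]
    exact ⟨by decide, by decide⟩
  · push Not at hodd
    right
    by_cases htriv : ∀ g, (g, (1 : S3)) ∈ H → g = 1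
    · -- `H` is the graph of a surjective, hence bijective map on the second factor.
      right
      choose ψ hψ using l2
      have huniq : ∀ g k, (g, k) ∈ H → g = ψ k := by
        intro g k hg
        have := htriv (g * (ψ k)⁻¹) (by simpa using H.mul_mem hg (H.inv_mem (hψ k)))
        exact mul_inv_eq_one.1 this
      have hsurj : Function.Surjective ψ := fun g => by
        obtain ⟨k, hk⟩ := l1 g
        exact ⟨k, (huniq g k hk).symm⟩
      have hinj := Finite.injective_iff_surjective.2 hsurj
      have hmul : ∀ x y, ψ (x * y) = ψ x * ψ y := fun x y =>
        (huniq _ _ (by simpa using H.mul_mem (hψ x) (hψ y))).symm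
      have hone : ψ 1 = 1 := (huniq _ _ H.one_mem).symm
      -- Two transpositions are sent to two transpositions, by an inner automorphism.
      have inner : ∀ u v : S3, u ≠ 1 ∧ u * u = 1 ∧ v ≠ 1 ∧ v * v = 1 ∧ u ≠ v →
          ∃ t : S3, Equiv.swap 0 1 = t * u * t⁻¹ ∧ Equiv.swap 1 2 = t * v * t⁻¹ := by decide
      have sq : ∀ s : S3, s * s = 1 → ψ s * ψ s = 1 := fun s hs => by rw [← hmul, hs, hone]
      have ne1 : ∀ s : S3, s ≠ 1 → ψ s ≠ 1 := fun s hs h => hs (hinj (h.trans hone.symm))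
      obtain ⟨t, ht1, ht2⟩ := inner (ψ (Equiv.swap 0 1)) (ψ (Equiv.swap 1 2))
        ⟨ne1 _ (by decide), sq _ (by decide), ne1 _ (by decide), sq _ (by decide),
          fun h => absurd (hinj h) (by decide)⟩
      have gen : ∀ g : S3, ∃ i j k : Bool, g = (if i then Equiv.swap 0 1 else 1) *
          (if j then Equiv.swap 1 2 else 1) * (if k then Equiv.swap 0 1 else 1) := by decide
      have conj : ∀ k, k = t * ψ k * t⁻¹ := by
        have e1 : ∀ i : Bool, (if i then Equiv.swap (0 : Fin 3) 1 else 1) =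
            t * ψ (if i then Equiv.swap 0 1 else 1) * t⁻¹ := by
          rintro (_ | _)
          · simp [hone]
          · simpa using ht1
        have e2 : ∀ i : Bool, (if i then Equiv.swap (1 : Fin 3) 2 else 1) =
            t * ψ (if i then Equiv.swap 1 2 else 1) * t⁻¹ := by
          rintro (_ | _)
          · simp [hone]
          · simpa using ht2
        intro k
        obtain ⟨i, j, l, rfl⟩ := gen k
        rw [hmul, hmul]
        conv_lhs => rw [e1 i, e2 j, e1 l]
        group
      have hP : ∀ g k, (g, k) ∈ H ↔ k = t * g * t⁻¹ := by
        intro g k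
        constructor
        · intro hg
          rw [huniq g k hg]
          exact conj k
        · intro hk
          have : g = ψ k := by
            have := hk.symm.trans (conj k)
            simpa using this
          rw [this]
          exact hψ k
      rw [orbitSizes_eq _ hP, card_eq_card_filter _ hP]
      clear * -
      exact ⟨by revert t; decide, by revert t; decide⟩
    · left
      push Not at htriv
      obtain ⟨c, hc, hc1⟩ := htriv
      have hce : sign c = 1 := by
        by_contra h
        exact hodd c h hc
      have even1 : ∀ g, sign g = 1 → (g, (1 : S3)) ∈ H := by
        have : ∀ c : S3, sign c = 1 → c ≠ 1 → ∀ g, sign g = 1 → g = 1 ∨ g = c ∨ g = c * c := by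
          decide
        intro g hg
        rcases this c hce hc1 g hg with rfl | rfl | rfl
        exacts [H.one_mem, hc, by simpa using H.mul_mem hc hc]
      have cube : ∀ k : S3, sign k = 1 → k * k * k = 1 := by decide
      have odd3 : ∀ k : S3, sign k ≠ 1 → k * k * k = k := by decide
      have key : ∀ g k, (g, k) ∈ H → sign k = 1 → sign g = 1 := by
        intro g k hg hk
        by_contra h
        refine hodd g h ?_
        have := H.mul_mem (H.mul_mem hg hg) hg
        simpa [cube k hk, odd3 g h] using this
      have sgn : ∀ x : ℤˣ, x ≠ 1 → x = -1 := by decide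
      have key' : ∀ g k, (g, k) ∈ H → sign g = 1 → sign k = 1 := by
        intro g k hg hge
        by_contra hk
        -- Multiplying a lift of a transposition by `(1, k)` makes its second component even.
        obtain ⟨x, hx⟩ := l1 (Equiv.swap 0 1)
        have hs : ¬ sign (Equiv.swap (0 : Fin 3) 1) = 1 := by decide
        refine hs (key _ (x * k) ?_ ?_)
        · simpa using H.mul_mem hx (H.mul_mem (H.inv_mem (even1 g hge)) hg)
        · rw [map_mul, sgn _ hk, sgn _ fun h => hs (key _ _ hx h)]
          rfl
      have hP : ∀ g k, (g, k) ∈ H ↔ sign g = sign k := by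
        have fwd : ∀ g k, (g, k) ∈ H → sign g = sign k := by
          intro g k hg
          by_cases hk : sign k = 1
          · rw [hk, key g k hg hk]
          · rw [sgn _ hk, sgn _ fun h => hk (key' g k hg h)]
        refine fun g k => ⟨fwd g k, fun hs => ?_⟩
        obtain ⟨x, hx⟩ := l2 k
        simpa using H.mul_mem (even1 (g * x⁻¹) (by rw [map_mul, map_inv, hs, fwd x k hx]; simp)) hx
      refine ⟨?_, ?_, hP⟩
      · rw [card_eq_card_filter _ hP]; decide
      · rw [orbitSizes_eq _ hP]; decide

theorem classification_S3_C3 (h1 : Nat.card (A₁ H) = 6) (h2 : Nat.card (A₂ H) = 3) :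
    Nat.card H = 18 ∧ orbitSizes H = {6, 6, 6, 6, 6, 6} := by
  have d1 := card_map_dvd (MonoidHom.fst S3 S3) H
  have d2 := card_dvd_mul_card_map (H := H)
  have h18 : Nat.card H = 6 ∨ Nat.card H = 18 := by
    rw [h1] at d1
    rw [h1, h2] at d2
    obtain ⟨m, hm⟩ := d1
    have : m ∣ 3 := Nat.dvd_of_mul_dvd_mul_left (k := 6) (by norm_num) (hm ▸ d2)
    rcases (Nat.dvd_prime Nat.prime_three).1 this with rfl | rfl <;> omega
  rcases h18 with h | h
  · -- `H` would be the graph of a homomorphism from `S₃` onto a group of order three.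
    exfalso
    have cube : ∀ k : S3, sign k = 1 → k * k = 1 → k = 1 := by decide
    have triv : ∀ s k : S3, s * s = 1 → (s, k) ∈ H → k = 1 := by
      intro s k hs hk
      have hk' : k ∈ A₂ H := ⟨_, hk, rfl⟩
      have := eq_one_of_card_map_eq (MonoidHom.fst S3 S3) (h.trans h1.symm) (H.mul_mem hk hk) hs
      exact cube k ((mem_iff_sign_of_card h2 k).1 hk') (congrArg Prod.snd this)
    have gen : ∀ g : S3, ∃ s t : S3, s * s = 1 ∧ t * t = 1 ∧ g = s * t := by decide
    have lift : ∀ g, ∃ k, (g, k) ∈ H := fun g =>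
      exists_mem_snd_of_mem_map (by rw [eq_top_of_card h1]; trivial)
    have hall : ∀ k ∈ A₂ H, k = 1 := by
      intro k hk
      obtain ⟨g, hg⟩ := exists_mem_fst_of_mem_map hk
      obtain ⟨s, t, hs, ht, rfl⟩ := gen g
      obtain ⟨x, hx⟩ := lift s
      obtain ⟨y, hy⟩ := lift t
      rw [triv s x hs hx] at hx
      rw [triv t y ht hy] at hy
      have := eq_one_of_card_map_eq (MonoidHom.fst S3 S3) (h.trans h1.symm)
        (H.mul_mem (H.inv_mem (H.mul_mem hx hy)) hg) (by simp)
      simpa using congrArg Prod.snd this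
    rw [(Subgroup.eq_bot_iff_forall _).2 hall, Subgroup.card_bot] at h2
    omega
  · have hP := mem_iff_of_card (H := H) (by rw [h, h1, h2])
    simp only [eq_top_of_card h1, mem_iff_sign_of_card h2, Subgroup.mem_top, true_and] at hP
    rw [orbitSizes_eq _ hP]
    exact ⟨h, by decide⟩

theorem classification_S3_C2 (h1 : Nat.card (A₁ H) = 6) (h2 : Nat.card (A₂ H) = 2) :
    (Nat.card H = 12 ∧ orbitSizes H = {6, 6, 6, 6, 6, 6}) ∨
    (Nat.card H = 6 ∧ orbitSizes H = {3, 3, 3, 3, 3, 3}) := by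
  have d1 := card_map_dvd (MonoidHom.fst S3 S3) H
  have d2 := card_dvd_mul_card_map (H := H)
  have h12 : Nat.card H = 6 ∨ Nat.card H = 12 := by
    rw [h1] at d1
    rw [h1, h2] at d2
    obtain ⟨m, hm⟩ := d1
    have : m ∣ 2 := Nat.dvd_of_mul_dvd_mul_left (k := 6) (by norm_num) (hm ▸ d2)
    rcases (Nat.dvd_prime Nat.prime_two).1 this with rfl | rfl <;> omega
  obtain ⟨s, hs1, hs, hA⟩ := exists_involution_of_card h2
  rcases h12 with h | h
  · right
    refine ⟨h, ?_⟩
    have inj := fun x (hx : x ∈ H) => eq_one_of_card_map_eq (MonoidHom.fst S3 S3)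
      (h.trans h1.symm) hx
    have lift : ∀ g, ∃ k, (g, k) ∈ H := fun g =>
      exists_mem_snd_of_mem_map (by rw [eq_top_of_card h1]; trivial)
    have two : ∀ g k, (g, k) ∈ H → k = 1 ∨ k = s := fun g k hk => (hA k).1 ⟨_, hk, rfl⟩
    have cube : ∀ g : S3, sign g = 1 → g * g * g = 1 := by decide
    have key : ∀ g k, (g, k) ∈ H → sign g = 1 → k = 1 := by
      intro g k hk hg
      have hk2 : k * k = 1 := by rcases two g k hk with rfl | rfl <;> simp [hs]
      have := inj _ (H.mul_mem (H.mul_mem hk hk) hk) (cube g hg)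
      have := congrArg Prod.snd this
      simpa [hk2] using this
    have sgn : ∀ x : ℤˣ, x ≠ 1 → x = -1 := by decide
    obtain ⟨g₀, hg₀⟩ := exists_mem_fst_of_mem_map (H := H) ((hA s).2 (Or.inr rfl))
    have hg₀s : sign g₀ ≠ 1 := fun hh => hs1 (key _ _ hg₀ hh)
    have fwd : ∀ g k, (g, k) ∈ H → k = if sign g = 1 then 1 else s := by
      intro g k hk
      split_ifs with hg
      · exact key g k hk hg
      · have := key _ _ (H.mul_mem hg₀ hk) (by rw [map_mul, sgn _ hg, sgn _ hg₀s]; rfl)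
        exact mul_left_cancel (a := s) (this.trans hs.symm)
    have hP : ∀ g k, (g, k) ∈ H ↔ k = if sign g = 1 then 1 else s := by
      refine fun g k => ⟨fwd g k, fun hk => ?_⟩
      obtain ⟨x, hx⟩ := lift g
      rw [hk, ← fwd g x hx]
      exact hx
    rw [orbitSizes_eq _ hP]
    clear * - hs hs1
    revert s
    decide
  · left
    have hP := mem_iff_of_card (H := H) (by rw [h, h1, h2])
    simp only [eq_top_of_card h1, hA, Subgroup.mem_top, true_and] at hP
    rw [orbitSizes_eq _ hP]
    refine ⟨h, ?_⟩
    clear * - hs hs1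
    revert s
    decide

theorem classification_C3_C3 (h1 : Nat.card (A₁ H) = 3) (h2 : Nat.card (A₂ H) = 3) :
    (Nat.card H = 9 ∧ orbitSizes H = {3, 3, 3, 3, 3, 3}) ∨
    (Nat.card H = 3 ∧ orbitSizes H = {3, 3, 3, 1, 1, 1}) := by
  have d1 := card_map_dvd (MonoidHom.fst S3 S3) H
  have d2 := card_dvd_mul_card_map (H := H)
  have h9 : Nat.card H = 3 ∨ Nat.card H = 9 := by
    rw [h1] at d1
    rw [h1, h2] at d2
    obtain ⟨m, hm⟩ := d1
    have : m ∣ 3 := Nat.dvd_of_mul_dvd_mul_left (k := 3) (by norm_num) (hm ▸ d2)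
    rcases (Nat.dvd_prime Nat.prime_three).1 this with rfl | rfl <;> omega
  rcases h9 with h | h
  · right
    refine ⟨h, ?_⟩
    have mem2 : ∀ g k, (g, k) ∈ H → sign k = 1 := fun g k hk =>
      (mem_iff_sign_of_card h2 k).1 ⟨_, hk, rfl⟩
    have mem1 : ∀ g k, (g, k) ∈ H → sign g = 1 := fun g k hk =>
      (mem_iff_sign_of_card h1 g).1 ⟨_, hk, rfl⟩
    -- `H` is generated by `(c, d)` for two `3`-cycles `c` and `d`, and these are conjugate.
    obtain ⟨d, hd⟩ := exists_mem_snd_of_mem_map (H := H)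
      ((mem_iff_sign_of_card h1 (finRotate 3)).2 (by decide))
    have hd1 : d ≠ 1 := by
      rintro rfl
      have := eq_one_of_card_map_eq (MonoidHom.snd S3 S3) (h.trans h2.symm) hd rfl
      exact absurd (congrArg Prod.fst this) (by decide)
    have conj : ∀ d : S3, sign d = 1 → d ≠ 1 → ∃ t : S3, d = t * finRotate 3 * t⁻¹ := by decide
    obtain ⟨t, rfl⟩ := conj d (mem2 _ _ hd) hd1
    have pow : ∀ g : S3, sign g = 1 → g = 1 ∨ g = finRotate 3 ∨ g = finRotate 3 * finRotate 3 := by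
      decide
    have bwd : ∀ g : S3, sign g = 1 → (g, t * g * t⁻¹) ∈ H := by
      intro g hg
      rcases pow g hg with rfl | rfl | rfl
      · rw [mul_one, mul_inv_cancel]
        exact H.one_mem
      · exact hd
      · simpa [mul_assoc] using H.mul_mem hd hd
    have hP : ∀ g k, (g, k) ∈ H ↔ sign g = 1 ∧ k = t * g * t⁻¹ := by
      refine fun g k => ⟨fun hk => ⟨mem1 g k hk, ?_⟩, fun ⟨hg, hk⟩ => hk ▸ bwd g hg⟩
      have := eq_one_of_card_map_eq (MonoidHom.fst S3 S3) (h.trans h1.symm)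
        (H.mul_mem hk (H.inv_mem (bwd g (mem1 g k hk)))) (by simp)
      exact mul_inv_eq_one.1 (congrArg Prod.snd this)
    rw [orbitSizes_eq _ hP]
    clear * -
    revert t
    decide
  · left
    have hP := mem_iff_of_card (H := H) (by rw [h, h1, h2])
    simp only [mem_iff_sign_of_card h1, mem_iff_sign_of_card h2] at hP
    rw [orbitSizes_eq _ hP]
    exact ⟨h, by decide⟩

theorem classification_C3_C2 (h1 : Nat.card (A₁ H) = 3) (h2 : Nat.card (A₂ H) = 2) :
    Nat.card H = 6 ∧ orbitSizes H = {6, 6, 6, 6, 6, 6} := by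
  have d1 := card_map_dvd (MonoidHom.fst S3 S3) H
  have d2 := card_map_dvd (MonoidHom.snd S3 S3) H
  have d3 := card_dvd_mul_card_map (H := H)
  rw [h1] at d1
  rw [h2] at d2
  rw [h1, h2] at d3
  have h : Nat.card H = 6 :=
    Nat.dvd_antisymm d3 (Nat.Coprime.mul_dvd_of_dvd_of_dvd (by norm_num) d1 d2)
  obtain ⟨s, hs1, hs, hA⟩ := exists_involution_of_card h2
  have hP := mem_iff_of_card (H := H) (by rw [h, h1, h2])
  simp only [mem_iff_sign_of_card h1, hA] at hP
  rw [orbitSizes_eq _ hP]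
  refine ⟨h, ?_⟩
  clear * - hs hs1
  revert s
  decide

theorem classification_C2_C2 (h1 : Nat.card (A₁ H) = 2) (h2 : Nat.card (A₂ H) = 2) :
    (Nat.card H = 4 ∧ orbitSizes H = {4, 4, 4, 4, 2, 2}) ∨
    (Nat.card H = 2 ∧ orbitSizes H = {2, 2, 2, 2, 1, 1}) := by
  have d1 := card_map_dvd (MonoidHom.fst S3 S3) H
  have d2 := card_dvd_mul_card_map (H := H)
  have h4 : Nat.card H = 2 ∨ Nat.card H = 4 := by
    rw [h1] at d1
    rw [h1, h2] at d2
    obtain ⟨m, hm⟩ := d1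
    have : m ∣ 2 := Nat.dvd_of_mul_dvd_mul_left (k := 2) (by norm_num) (hm ▸ d2)
    rcases (Nat.dvd_prime Nat.prime_two).1 this with rfl | rfl <;> omega
  obtain ⟨s, hs1, hs, hA⟩ := exists_involution_of_card h1
  obtain ⟨t, ht1, ht, hB⟩ := exists_involution_of_card h2
  rcases h4 with h | h
  · right
    refine ⟨h, ?_⟩
    have mem1 : ∀ g k, (g, k) ∈ H → g = 1 ∨ g = s := fun g k hk => (hA g).1 ⟨_, hk, rfl⟩
    have mem2 : ∀ g k, (g, k) ∈ H → k = 1 ∨ k = t := fun g k hk => (hB k).1 ⟨_, hk, rfl⟩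
    have inj1 : ∀ g k, (g, k) ∈ H → g = 1 → k = 1 := fun g k hk hg => congrArg Prod.snd
      (eq_one_of_card_map_eq (MonoidHom.fst S3 S3) (h.trans h1.symm) hk hg)
    have inj2 : ∀ g k, (g, k) ∈ H → k = 1 → g = 1 := fun g k hk hg => congrArg Prod.fst
      (eq_one_of_card_map_eq (MonoidHom.snd S3 S3) (h.trans h2.symm) hk hg)
    have hst : (s, t) ∈ H := by
      obtain ⟨k, hk⟩ := exists_mem_snd_of_mem_map (H := H) ((hA s).2 (Or.inr rfl))
      rcases mem2 s k hk with rfl | rfl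
      · exact absurd (inj2 s 1 hk rfl) hs1
      · exact hk
    have hP : ∀ g k, (g, k) ∈ H ↔ g = 1 ∧ k = 1 ∨ g = s ∧ k = t := by
      refine fun g k => ⟨fun hk => ?_, ?_⟩
      · rcases mem1 g k hk with hg | rfl
        · exact Or.inl ⟨hg, inj1 g k hk hg⟩
        · rcases mem2 g k hk with rfl | rfl
          · exact absurd (inj2 g 1 hk rfl) hs1
          · exact Or.inr ⟨rfl, rfl⟩
      · rintro (⟨rfl, rfl⟩ | ⟨rfl, rfl⟩)
        exacts [H.one_mem, hst]
    rw [orbitSizes_eq _ hP]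
    clear * - hs hs1 ht ht1
    revert s t
    decide
  · left
    have hP := mem_iff_of_card (H := H) (by rw [h, h1, h2])
    simp only [hA, hB] at hP
    rw [orbitSizes_eq _ hP]
    refine ⟨h, ?_⟩
    clear * - hs hs1 ht ht1
    revert s t
    decide

end Classification

section Isomorphisms

/-- The pairs of permutations of equal sign, written as a semidirect product: `C₃ × C₃` acts by
powers of a `3`-cycle in each factor, and `C₂` by a transposition in both factors at once. -/
def c3c3c2ToProd : C3C3C2 →* S3 × S3 where
  toFun x := (finRotate 3 ^ x.left.1.toAdd.val * Equiv.swap 0 1 ^ x.right.toAdd.val,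
    finRotate 3 ^ x.left.2.toAdd.val * Equiv.swap 0 1 ^ x.right.toAdd.val)
  map_one' := by decide
  map_mul' := by
    have key : ∀ (i j : Cyc 3) (c d : Cyc 2),
        (finRotate 3 ^ (i * (if c = 1 then j else j⁻¹)).toAdd.val *
          Equiv.swap 0 1 ^ (c * d).toAdd.val : S3) =
        finRotate 3 ^ i.toAdd.val * Equiv.swap 0 1 ^ c.toAdd.val *
          (finRotate 3 ^ j.toAdd.val * Equiv.swap 0 1 ^ d.toAdd.val) := by decide
    rintro ⟨⟨i, i'⟩, c⟩ ⟨⟨j, j'⟩, d⟩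
    have e : ∀ x : Cyc 3 × Cyc 3, inversionAction (Cyc 3 × Cyc 3) c x =
        (if c = 1 then x.1 else x.1⁻¹, if c = 1 then x.2 else x.2⁻¹) := by
      intro x
      by_cases hc : c = 1 <;> simp [inversionAction, hc, Prod.ext_iff]
    ext1
    · simpa [e] using key i j c d
    · simpa [e] using key i' j' c d

theorem c3c3c2ToProd_injective : Function.Injective c3c3c2ToProd := by
  have key : ∀ (i j : Cyc 3) (c : Cyc 2),
      (finRotate 3 ^ i.toAdd.val * Equiv.swap 0 1 ^ c.toAdd.val : S3) = 1 → i = 1 ∧ c = 1 := by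
    decide
  rw [injective_iff_map_eq_one]
  rintro ⟨⟨i, i'⟩, c⟩ h
  obtain ⟨rfl, rfl⟩ := key i 1 c (congrArg Prod.fst h)
  obtain ⟨rfl, -⟩ := key i' 1 1 (congrArg Prod.snd h)
  rfl

theorem iso_C3C3C2_of_mem_iff {H : Subgroup (S3 × S3)} (h : Nat.card H = 18)
    (hP : ∀ g k, (g, k) ∈ H ↔ sign g = sign k) : Iso H C3C3C2 := by
  have hr : c3c3c2ToProd.range = H := by
    refine Subgroup.eq_of_le_of_card_ge ?_ ?_
    · rintro _ ⟨x, rfl⟩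
      have hrot : sign (finRotate 3) = 1 := by decide
      refine (hP _ _).2 ?_
      simp [hrot]
    · rw [h, ← Nat.card_congr (MonoidHom.ofInjective c3c3c2ToProd_injective).toEquiv,
        Nat.card_congr SemidirectProduct.equivProd]
      simp
  exact ⟨((MonoidHom.ofInjective c3c3c2ToProd_injective).trans
    (MulEquiv.subgroupCongr hr)).symm⟩

theorem iso_S3_prod_C2 : Iso (S3 × Cyc 2) (DihedralGroup 6) := by
  let f : DihedralGroup 6 → S3 × Cyc 2 := fun x => match x with
    | .r i => (finRotate 3 ^ i.val, Multiplicative.ofAdd (i.val : ZMod 2))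
    | .sr i => (Equiv.swap 0 1 * finRotate 3 ^ i.val, Multiplicative.ofAdd (i.val : ZMod 2))
  have hmul : ∀ x y, f (x * y) = f x * f y := by decide
  have hinj : Function.Injective f := by decide
  refine ⟨(MulEquiv.ofBijective (MonoidHom.mk' f hmul)
    (hinj.bijective_of_nat_card_le ?_)).symm⟩
  rw [Nat.card_prod, card_S3, DihedralGroup.nat_card]
  simp

theorem iso_C3_prod_C2 : Iso (Cyc 3 × Cyc 2) (Cyc 6) :=
  ⟨(MulEquiv.prodMultiplicative (ZMod 3) (ZMod 2)).symm.trans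
    (ZMod.chineseRemainder (m := 3) (n := 2) (by norm_num)).symm.toAddEquiv.toMultiplicative⟩

end Isomorphisms

/-! ### Tschirnhausen transformations between two cubics -/

/-- The three values of `θ` are distinct roots of `X³ + aX + a`, hence all of them. -/
structure IsRootTriple {K : Type*} [Field K] (a : K) (θ : Fin 3 → K) : Prop where
  injective : Function.Injective θ
  eval_eq_zero : ∀ i, θ i ^ 3 + a * θ i + a = 0

namespace IsRootTriple

variable {K : Type*} [Field K] {a b : K} {θ η : Fin 3 → K}

theorem comp_perm (h : IsRootTriple a θ) (σ : S3) : IsRootTriple a (θ ∘ σ) :=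
  ⟨h.injective.comp σ.injective, fun i => h.eval_eq_zero (σ i)⟩

theorem sum_eq_zero (h : IsRootTriple a θ) : θ 0 + θ 1 + θ 2 = 0 := by
  have h01 : θ 0 - θ 1 ≠ 0 := sub_ne_zero.2 (h.injective.ne (by decide))
  have h02 : θ 0 - θ 2 ≠ 0 := sub_ne_zero.2 (h.injective.ne (by decide))
  have h12 : θ 1 - θ 2 ≠ 0 := sub_ne_zero.2 (h.injective.ne (by decide))
  refine mul_left_cancel₀ (mul_ne_zero (mul_ne_zero h01 h02) h12) ?_
  linear_combination (θ 1 - θ 2) * h.eval_eq_zero 0 - (θ 0 - θ 2) * h.eval_eq_zero 1 +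
    (θ 0 - θ 1) * h.eval_eq_zero 2

theorem sum_mul_eq (h : IsRootTriple a θ) : θ 0 * θ 1 + θ 0 * θ 2 + θ 1 * θ 2 = a := by
  have h01 : θ 0 - θ 1 ≠ 0 := sub_ne_zero.2 (h.injective.ne (by decide))
  refine mul_left_cancel₀ h01 ?_
  linear_combination -h.eval_eq_zero 0 + h.eval_eq_zero 1 +
    (θ 0 - θ 1) * (θ 0 + θ 1) * h.sum_eq_zero

theorem prod_eq (h : IsRootTriple a θ) : θ 0 * θ 1 * θ 2 = -a := by
  linear_combination h.eval_eq_zero 0 - θ 0 ^ 2 * h.sum_eq_zero + θ 0 * h.sum_mul_eq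

/-- An affine map between root triples is the identity: it is linear because both traces vanish,
and the ratio `e₂³ / e₃²` together with `e₂ = - e₃` fixes the scaling factor. -/
theorem eq_of_affine (h3 : (3 : K) ≠ 0) (hb : b ≠ 0) (hθ : IsRootTriple a θ)
    (hη : IsRootTriple b η) {u w : K} (h : ∀ i, η i = u * θ i + w) : η = θ := by
  have hw : w = 0 := by
    refine mul_left_cancel₀ h3 ?_
    linear_combination hη.sum_eq_zero - u * hθ.sum_eq_zero - h 0 - h 1 - h 2
  subst hw
  simp only [add_zero] at h
  have e2 : b = u ^ 2 * a := by
    rw [← hη.sum_mul_eq, ← hθ.sum_mul_eq, h 0, h 1, h 2]; ring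
  have e3 : b = u ^ 3 * a := by
    have := hη.prod_eq
    rw [h 0, h 1, h 2] at this
    linear_combination this - u ^ 3 * hθ.prod_eq
  have hu : u = 1 := by
    refine mul_left_cancel₀ hb ?_
    linear_combination u * e2 - e3
  funext i
  rw [h i, hu, one_mul]

/-- Powers `1, θ, θ²` are linearly independent on three distinct values. -/
theorem quadratic_eq_zero (h : IsRootTriple a θ) {x y z : K}
    (hq : ∀ i, x + y * θ i + z * θ i ^ 2 = 0) : x = 0 ∧ y = 0 ∧ z = 0 := by
  have h01 : θ 0 - θ 1 ≠ 0 := sub_ne_zero.2 (h.injective.ne (by decide))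
  have h02 : θ 0 - θ 2 ≠ 0 := sub_ne_zero.2 (h.injective.ne (by decide))
  have h12 : θ 1 - θ 2 ≠ 0 := sub_ne_zero.2 (h.injective.ne (by decide))
  have hz : z = 0 := by
    refine mul_left_cancel₀ (mul_ne_zero (mul_ne_zero h01 h02) h12) ?_
    linear_combination (θ 1 - θ 2) * hq 0 - (θ 0 - θ 2) * hq 1 + (θ 0 - θ 1) * hq 2
  subst hz
  have hy : y = 0 := by
    refine mul_left_cancel₀ h01 ?_
    linear_combination hq 0 - hq 1
  subst hy
  exact ⟨by simpa using hq 0, rfl, rfl⟩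

theorem exists_quadratic (h : IsRootTriple a θ) (η : Fin 3 → K) :
    ∃ x y z : K, ∀ i, η i = x + y * θ i + z * θ i ^ 2 := by
  have h01 : θ 0 - θ 1 ≠ 0 := sub_ne_zero.2 (h.injective.ne (by decide))
  have h02 : θ 0 - θ 2 ≠ 0 := sub_ne_zero.2 (h.injective.ne (by decide))
  have h12 : θ 1 - θ 2 ≠ 0 := sub_ne_zero.2 (h.injective.ne (by decide))
  -- The coefficients are those of the Lagrange interpolation polynomial.
  refine ⟨η 0 * θ 1 * θ 2 / ((θ 0 - θ 1) * (θ 0 - θ 2)) -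
      η 1 * θ 0 * θ 2 / ((θ 0 - θ 1) * (θ 1 - θ 2)) + η 2 * θ 0 * θ 1 / ((θ 0 - θ 2) * (θ 1 - θ 2)),
    -η 0 * (θ 1 + θ 2) / ((θ 0 - θ 1) * (θ 0 - θ 2)) +
      η 1 * (θ 0 + θ 2) / ((θ 0 - θ 1) * (θ 1 - θ 2)) -
      η 2 * (θ 0 + θ 1) / ((θ 0 - θ 2) * (θ 1 - θ 2)),
    η 0 / ((θ 0 - θ 1) * (θ 0 - θ 2)) - η 1 / ((θ 0 - θ 1) * (θ 1 - θ 2)) +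
      η 2 / ((θ 0 - θ 2) * (θ 1 - θ 2)), ?_⟩
  intro i
  fin_cases i <;> (simp; field_simp; ring)

end IsRootTriple

variable {K : Type*} [Field K] {a b : K} {θ η : Fin 3 → K}

/-- The parameter `c` of the Tschirnhausen transformation carrying `θ i` to `η (σ i)`: up to an
affine change of the target, the transformation is `θ ↦ (c / 3) θ + θ²`. -/
def IsParameter (θ η : Fin 3 → K) (σ : S3) (c : K) : Prop :=
  ∃ l m : K, ∀ i, 3 * η (σ i) = l * (c * θ i + 3 * θ i ^ 2) + m

theorem exists_isParameter (h3 : (3 : K) ≠ 0) (hab : a ≠ b) (hb : b ≠ 0)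
    (hθ : IsRootTriple a θ) (hη : IsRootTriple b η) (σ : S3) : ∃ c, IsParameter θ η σ c := by
  obtain ⟨x, y, z, h⟩ := hθ.exists_quadratic (η ∘ σ)
  have hz : z ≠ 0 := by
    rintro rfl
    have := hθ.eq_of_affine h3 hb (hη.comp_perm σ) (u := y) (w := x) fun i => by rw [h i]; ring
    exact hab (hθ.sum_mul_eq.symm.trans (this ▸ (hη.comp_perm σ).sum_mul_eq))
  refine ⟨3 * y / z, z, 3 * x, fun i => ?_⟩
  have := h i
  simp only [Function.comp_apply] at this
  rw [this]
  field_simp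
  ring

theorem IsParameter.scale_ne_zero (hη : IsRootTriple b η) (h3 : (3 : K) ≠ 0) {σ : S3} {c l m : K}
    (h : ∀ i, 3 * η (σ i) = l * (c * θ i + 3 * θ i ^ 2) + m) : l ≠ 0 := by
  rintro rfl
  have := mul_left_cancel₀ h3 ((h 0).trans ((by ring : _ = _).trans (h 1).symm))
  exact absurd (σ.injective (hη.injective this)) (by decide)

theorem IsParameter.unique (h3 : (3 : K) ≠ 0) (hθ : IsRootTriple a θ) (hη : IsRootTriple b η)
    {σ : S3} {c c' : K} (h : IsParameter θ η σ c) (h' : IsParameter θ η σ c') : c = c' := by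
  obtain ⟨l, m, h⟩ := h
  obtain ⟨l', m', h'⟩ := h'
  have hl := IsParameter.scale_ne_zero hη h3 h
  obtain ⟨-, h1, h2⟩ := hθ.quadratic_eq_zero (x := m - m') (y := l * c - l' * c')
    (z := 3 * (l - l')) fun i => by linear_combination h' i - h i
  have hll : l = l' := sub_eq_zero.1 ((mul_eq_zero.1 h2).resolve_left h3)
  subst hll
  exact mul_left_cancel₀ hl (sub_eq_zero.1 h1)

/-- Different bijections of the roots have different parameters. -/
theorem IsParameter.perm_unique (h3 : (3 : K) ≠ 0) (hb : b ≠ 0)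
    (hη : IsRootTriple b η) {σ τ : S3} {c : K} (h : IsParameter θ η σ c)
    (h' : IsParameter θ η τ c) : σ = τ := by
  obtain ⟨l, m, h⟩ := h
  obtain ⟨l', m', h'⟩ := h'
  have hl' := IsParameter.scale_ne_zero hη h3 h'
  have := (hη.comp_perm τ).eq_of_affine h3 hb (hη.comp_perm σ) (u := l / l')
    (w := (m - l / l' * m') / 3) fun i => by
      refine mul_left_cancel₀ h3 ?_
      simp only [Function.comp_apply]
      have e : c * θ i + 3 * θ i ^ 2 = (3 * η (τ i) - m') / l' := by
        rw [h' i]; field_simp; ring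
      rw [h i, e]
      field_simp
      ring
  exact Equiv.ext fun i => hη.injective (congrFun this i)

/-- The parameters are roots of the sextic: with `S` and `R` the quadratic and the cubic in
`F_{a,b} = a S³ - b R²`, the second and third symmetric functions of the transformed roots give
`9b = l² a S` and `27b = ± l³ a R`. -/
theorem IsParameter.eval_sextic (h3 : (3 : K) ≠ 0) (ha : a ≠ 0)
    (hθ : IsRootTriple a θ) (hη : IsRootTriple b η) {σ : S3} {c : K} (h : IsParameter θ η σ c) :
    (sextic a b).eval c = 0 := by
  obtain ⟨l, m, h⟩ := h
  have hl := IsParameter.scale_ne_zero hη h3 h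
  have hη' := hη.comp_perm σ
  have e1 := hη'.sum_eq_zero
  have e2 := hη'.sum_mul_eq
  have e3 := hη'.prod_eq
  simp only [Function.comp_apply] at e1 e2 e3
  have t2 : θ 2 = -θ 0 - θ 1 := by linear_combination hθ.sum_eq_zero
  have a2 := hθ.sum_mul_eq
  have a3 := hθ.prod_eq
  have hm : m = 2 * l * a := by
    refine mul_left_cancel₀ h3 ?_
    linear_combination 3 * e1 - h 0 - h 1 - h 2 -
      (l * c + 3 * l * (θ 0 + θ 1 + θ 2)) * hθ.sum_eq_zero + 6 * l * a2
  have q2 : 9 * b = l ^ 2 * (a * (c ^ 2 + 9 * c - 3 * a)) := by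
    have : 9 * b = l ^ 2 * (c ^ 2 * (θ 0 * θ 1 + θ 0 * θ 2 + θ 1 * θ 2) -
        9 * c * (θ 0 * θ 1 * θ 2) + 9 * (θ 0 * θ 1 + θ 0 * θ 2 + θ 1 * θ 2) ^ 2) -
        12 * l * m * (θ 0 * θ 1 + θ 0 * θ 2 + θ 1 * θ 2) + 3 * m ^ 2 := by
      have : 9 * b = 3 * η (σ 0) * (3 * η (σ 1)) + 3 * η (σ 0) * (3 * η (σ 2)) +
          3 * η (σ 1) * (3 * η (σ 2)) := by rw [← e2]; ring
      rw [this, h 0, h 1, h 2, t2]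
      ring
    rw [this, a2, a3, hm]
    ring
  have q3 : 27 * b =
      l ^ 3 * (a * (c ^ 3 - 2 * a * c ^ 2 - 9 * a * c - (2 * a ^ 2 + 27 * a))) := by
    have : -(27 * b) = l ^ 3 * (θ 0 * θ 1 * θ 2 * (c ^ 3 +
        9 * c * (θ 0 * θ 1 + θ 0 * θ 2 + θ 1 * θ 2) + 27 * (θ 0 * θ 1 * θ 2))) +
        l ^ 2 * m * (c ^ 2 * (θ 0 * θ 1 + θ 0 * θ 2 + θ 1 * θ 2) -
          9 * c * (θ 0 * θ 1 * θ 2) + 9 * (θ 0 * θ 1 + θ 0 * θ 2 + θ 1 * θ 2) ^ 2) -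
        6 * l * m ^ 2 * (θ 0 * θ 1 + θ 0 * θ 2 + θ 1 * θ 2) + m ^ 3 := by
      have : -(27 * b) = 3 * η (σ 0) * (3 * η (σ 1)) * (3 * η (σ 2)) := by
        linear_combination -27 * e3
      rw [this, h 0, h 1, h 2, t2]
      ring
    rw [a2, a3, hm] at this
    linear_combination -this
  have key : l ^ 6 * a ^ 2 * (a * (c ^ 2 + 9 * c - 3 * a) ^ 3 -
      b * (c ^ 3 - 2 * a * c ^ 2 - 9 * a * c - (2 * a ^ 2 + 27 * a)) ^ 2) = 0 := by
    linear_combination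
      -((9 * b) ^ 2 + 9 * b * (l ^ 2 * (a * (c ^ 2 + 9 * c - 3 * a))) +
        (l ^ 2 * (a * (c ^ 2 + 9 * c - 3 * a))) ^ 2) * q2 +
      b * (27 * b +
        l ^ 3 * (a * (c ^ 3 - 2 * a * c ^ 2 - 9 * a * c - (2 * a ^ 2 + 27 * a)))) * q3
  simpa [sextic] using (mul_eq_zero.1 key).resolve_left
    (mul_ne_zero (pow_ne_zero _ hl) (pow_ne_zero _ ha))

theorem natDegree_sextic (hab : a ≠ b) : (sextic a b).natDegree = 6 := by
  have hS : (X ^ 2 + 9 * X - C (3 * a) : K[X]).Monic := by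
    have : (X ^ 2 + 9 * X - C (3 * a) : K[X]) = X ^ 2 + (C 9 * X - C (3 * a)) := by
      rw [map_ofNat]; ring
    rw [this]
    exact monic_X_pow_add (by compute_degree!)
  have hR : (X ^ 3 - C (2 * a) * X ^ 2 - C (9 * a) * X - C (2 * a ^ 2 + 27 * a) : K[X]).Monic := by
    have : (X ^ 3 - C (2 * a) * X ^ 2 - C (9 * a) * X - C (2 * a ^ 2 + 27 * a) : K[X]) =
        X ^ 3 + (-C (2 * a) * X ^ 2 - C (9 * a) * X - C (2 * a ^ 2 + 27 * a)) := by
      ring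
    rw [this]
    exact monic_X_pow_add (by compute_degree!)
  have dS : (X ^ 2 + 9 * X - C (3 * a) : K[X]).natDegree = 2 := by compute_degree!
  have dR : (X ^ 3 - C (2 * a) * X ^ 2 - C (9 * a) * X - C (2 * a ^ 2 + 27 * a) : K[X]).natDegree
      = 3 := by compute_degree!
  have dS3 := hS.natDegree_pow 3
  have dR2 := hR.natDegree_pow 2
  rw [dS] at dS3
  rw [dR] at dR2
  refine natDegree_eq_of_le_of_coeff_ne_zero ?_ (n := 6) ?_
  · refine (natDegree_sub_le _ _).trans (max_le ?_ ?_)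
    · exact (natDegree_C_mul_le _ _).trans dS3.le
    · exact (natDegree_C_mul_le _ _).trans dR2.le
  · have c1 := (hS.pow 3).coeff_natDegree
    have c2 := (hR.pow 2).coeff_natDegree
    rw [dS3] at c1
    rw [dR2] at c2
    rw [sextic, coeff_sub, coeff_C_mul, coeff_C_mul, c1, c2, mul_one, mul_one]
    exact sub_ne_zero.2 hab

theorem map_sextic {L : Type*} [Field L] (f : K →+* L) :
    (sextic a b).map f = sextic (f a) (f b) := by
  simp [sextic, map_ofNat f]

/-- The six parameters are all the roots of the sextic. -/
theorem roots_sextic (h3 : (3 : K) ≠ 0) (hab : a ≠ b) (ha : a ≠ 0) (hb : b ≠ 0)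
    (hθ : IsRootTriple a θ) (hη : IsRootTriple b η) {c : S3 → K}
    (hc : ∀ σ, IsParameter θ η σ (c σ)) :
    (sextic a b).roots = (Finset.univ : Finset S3).val.map c := by
  have hinj : Function.Injective c := fun σ τ h =>
    IsParameter.perm_unique h3 hb hη (hc σ) (h ▸ hc τ)
  have hne : sextic a b ≠ 0 := ne_zero_of_natDegree_gt (n := 0) (by rw [natDegree_sextic hab]; simp)
  refine (Multiset.eq_of_le_of_card_le ?_ ?_).symm
  · rw [Multiset.le_iff_subset (Finset.univ.nodup.map hinj)]
    intro x hx
    obtain ⟨σ, -, rfl⟩ := Multiset.mem_map.1 hx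
    exact (mem_roots hne).2 ((hc σ).eval_sextic h3 ha hθ hη)
  · refine (card_roots' _).trans ?_
    rw [natDegree_sextic hab, Multiset.card_map]
    exact (by decide : 6 ≤ Multiset.card (Finset.univ : Finset S3).val)

/-! ### Decomposition types -/

/-- Over an algebraically closed field, each irreducible factor of degree `d` contributes `d` roots,
and each of these has degree `d`. -/
theorem map_natDegree_minpoly_aroots {M Ω : Type*} [Field M] [Field Ω] [Algebra M Ω]
    [IsAlgClosed Ω] {f : M[X]} (hf : f ≠ 0) :
    (f.aroots Ω).map (fun x => (minpoly M x).natDegree) =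
      (decompositionType f).bind fun d => Multiset.replicate d d := by
  have hirr := fun p hp => UniqueFactorizationMonoid.irreducible_of_factor (a := f) p hp
  have h0 : (0 : M[X]) ∉ UniqueFactorizationMonoid.factors f := fun h => (hirr 0 h).ne_zero rfl
  have hroots : f.aroots Ω =
      (UniqueFactorizationMonoid.factors f).bind fun p => p.aroots Ω := by
    obtain ⟨u, hu⟩ := UniqueFactorizationMonoid.factors_prod hf
    obtain ⟨r, hr, hru⟩ := Polynomial.isUnit_iff.1 u.isUnit
    conv_lhs => rw [← hu, ← hru, mul_comm, aroots_C_mul _ hr.ne_zero]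
    rw [aroots_def, Polynomial.map_multiset_prod, roots_multiset_prod, Multiset.bind_map]
    rw [Multiset.mem_map]
    rintro ⟨p, hp, h⟩
    exact (hirr p hp).ne_zero ((Polynomial.map_eq_zero _).1 h)
  rw [hroots, Multiset.map_bind, decompositionType, Multiset.bind_map]
  refine Multiset.bind_congr fun p hp => ?_
  rw [Multiset.eq_replicate]
  refine ⟨?_, ?_⟩
  · rw [Multiset.card_map, aroots_def, IsAlgClosed.card_roots_eq_natDegree, natDegree_map]
  · intro d hd
    obtain ⟨x, hx, rfl⟩ := Multiset.mem_map.1 hd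
    rw [← minpoly.eq_of_irreducible (hirr p hp) (mem_aroots.1 hx).2,
      natDegree_mul_C (inv_ne_zero (leadingCoeff_ne_zero.2 (hirr p hp).ne_zero))]

theorem count_bind_replicate (m : Multiset ℕ) (d : ℕ) :
    (m.bind fun d => Multiset.replicate d d).count d = d * m.count d := by
  induction m using Multiset.induction with
  | empty => simp
  | cons e m ih =>
    rw [Multiset.cons_bind, Multiset.count_add, ih, Multiset.count_replicate, Multiset.count_cons]
    by_cases h : d = e
    · subst h; simp; ring
    · simp [h, Ne.symm h]

/-- Repeating every part `d` of a partition `d` times loses no information. -/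
theorem eq_of_bind_replicate_eq {m n : Multiset ℕ} (hm : 0 ∉ m) (hn : 0 ∉ n)
    (h : (m.bind fun d => Multiset.replicate d d) = n.bind fun d => Multiset.replicate d d) :
    m = n := by
  ext d
  rcases Nat.eq_zero_or_pos d with rfl | hd
  · rw [Multiset.count_eq_zero_of_notMem hm, Multiset.count_eq_zero_of_notMem hn]
  · have := congrArg (Multiset.count d) h
    rw [count_bind_replicate, count_bind_replicate] at this
    exact Nat.eq_of_mul_eq_mul_left hd this

theorem zero_notMem_decompositionType {M : Type*} [Field M] (f : M[X]) :
    0 ∉ decompositionType f := by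
  intro h
  obtain ⟨p, hp, h0⟩ := Multiset.mem_map.1 h
  exact (UniqueFactorizationMonoid.irreducible_of_factor p hp).natDegree_pos.ne' h0

/-! ### The Galois action on the roots -/

section GaloisAction

variable {M : Type*} [Field M]

theorem natDegree_cubic (a : M) : (cubic a).natDegree = 3 := by
  unfold cubic
  compute_degree!

theorem separable_cubic {a : M} (h : a * (4 * a + 27) ≠ 0) : (cubic a).Separable := by
  have ha : a ≠ 0 := left_ne_zero_of_mul h
  have hd : a ^ 2 * (4 * a + 27) ≠ 0 := by
    rw [pow_two, mul_assoc]
    exact mul_ne_zero ha h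
  -- A Bezout relation between the cubic and its derivative, with value the discriminant.
  have key : (C (18 * a) * X - C (27 * a)) * cubic a +
      (-C (6 * a) * X ^ 2 + C (9 * a) * X - C (4 * a ^ 2)) * derivative (cubic a) =
        -C (a ^ 2 * (4 * a + 27)) := by
    simp only [cubic, derivative_X_pow, derivative_mul, derivative_C, derivative_X,
      map_mul, map_add, map_pow, map_ofNat, Nat.cast_ofNat]
    ring
  refine ⟨-C (a ^ 2 * (4 * a + 27))⁻¹ * (C (18 * a) * X - C (27 * a)),
    -C (a ^ 2 * (4 * a + 27))⁻¹ * (-C (6 * a) * X ^ 2 + C (9 * a) * X - C (4 * a ^ 2)), ?_⟩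
  rw [mul_assoc, mul_assoc, ← mul_add, key, neg_mul_neg, ← C_mul, inv_mul_cancel₀ hd, C_1]

/-- Two different cubics of the family have no common root, as `-1` is a root of neither. -/
theorem isCoprime_cubic {a b : M} (hab : a ≠ b) : IsCoprime (cubic a) (cubic b) := by
  have h : C (a - b)⁻¹ * (C a - C b) = (1 : M[X]) := by
    rw [← C_sub, ← C_mul, inv_mul_cancel₀ (sub_ne_zero.2 hab), C_1]
  refine ⟨C (a - b)⁻¹ * (X ^ 2 - X + 1 + C a) - 1, -C (a - b)⁻¹ * (X ^ 2 - X + 1 + C a), ?_⟩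
  unfold cubic
  linear_combination (X + 1) * (X ^ 2 - X + 1 + C a) * h

variable {Ω : Type*} [Field Ω] [Algebra M Ω]

/-- Group homomorphisms with the same kernel from the same group have isomorphic images. -/
theorem iso_range_of_surjective {Γ A B : Type*} [Group Γ] [Group A] [Group B] (f : Γ →* A)
    (g : Γ →* B) (hf : Function.Surjective f) (h : ∀ x, f x = 1 ↔ g x = 1) : Iso A g.range := by
  have hk : f.ker = g.ker := by
    ext x
    exact h x
  exact ⟨(QuotientGroup.quotientKerEquivOfSurjective f hf).symm.trans
    ((QuotientGroup.quotientMulEquivOfEq hk).trans (QuotientGroup.quotientKerEquivRange g))⟩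

theorem restrict_eq_one_iff (f : M[X]) [Fact ((f.map (algebraMap M Ω)).Splits)]
    (γ : Gal(Ω/M)) : Gal.restrict f Ω γ = 1 ↔ ∀ x ∈ f.rootSet Ω, γ x = x := by
  constructor
  · intro h x hx
    have := Gal.galActionHom_restrict f Ω γ ⟨x, hx⟩
    rw [h, map_one] at this
    exact this.symm
  · intro h
    refine Gal.galActionHom_injective f Ω ?_
    rw [map_one]
    ext x
    rw [Gal.galActionHom_restrict]
    exact h x x.2

/-- The permutation representation of the Galois group of `Ω` on three enumerated roots. -/
theorem exists_rootTriple [IsAlgClosed Ω] {a : M} (h : a * (4 * a + 27) ≠ 0) :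
    ∃ (θ : Fin 3 → Ω) (ρ : Gal(Ω/M) →* S3), IsRootTriple (algebraMap M Ω a) θ ∧
      (cubic a).rootSet Ω = Set.range θ ∧ ∀ γ i, γ (θ i) = θ (ρ γ i) := by
  have hs : ((cubic a).map (algebraMap M Ω)).Splits := IsAlgClosed.splits _
  have := Fact.mk hs
  have hcard := card_rootSet_eq_natDegree (separable_cubic h) hs
  rw [natDegree_cubic] at hcard
  let e : (cubic a).rootSet Ω ≃ Fin 3 := Fintype.equivFinOfCardEq hcard
  refine ⟨fun i => e.symm i, e.permCongrHom.toMonoidHom.comp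
    ((Gal.galActionHom (cubic a) Ω).comp (Gal.restrict (cubic a) Ω)), ⟨?_, ?_⟩, ?_, ?_⟩
  · exact Subtype.val_injective.comp e.symm.injective
  · intro i
    have := (mem_rootSet.1 (e.symm i).2).2
    simpa [cubic] using this
  · ext x
    constructor
    · intro hx
      exact ⟨e ⟨x, hx⟩, by simp⟩
    · rintro ⟨i, rfl⟩
      exact (e.symm i).2
  · intro γ i
    simp [Gal.galActionHom_restrict]

theorem iso_gal_range [IsAlgClosed Ω] [Normal M Ω] {f : M[X]} {Q : Type*} [Group Q] (g : Gal(Ω/M) →* Q)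
    (h : ∀ γ, g γ = 1 ↔ ∀ x ∈ f.rootSet Ω, γ x = x) : Iso f.Gal g.range := by
  have : Fact ((f.map (algebraMap M Ω)).Splits) := ⟨IsAlgClosed.splits _⟩
  exact iso_range_of_surjective (Gal.restrict f Ω) g (Gal.restrict_surjective f Ω)
    fun γ => (restrict_eq_one_iff f γ).trans (h γ).symm

theorem eq_one_iff_of_action {a : M} {θ : Fin 3 → Ω} {ρ : Gal(Ω/M) →* S3}
    (hθ : Function.Injective θ) (hr : (cubic a).rootSet Ω = Set.range θ)
    (hρ : ∀ γ i, γ (θ i) = θ (ρ γ i)) (γ : Gal(Ω/M)) :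
    ρ γ = 1 ↔ ∀ x ∈ (cubic a).rootSet Ω, γ x = x := by
  rw [hr, Set.forall_mem_range, Equiv.ext_iff]
  exact forall_congr' fun i => by rw [hρ, hθ.eq_iff]; rfl

/-- The degree of an element with separable minimal polynomial that splits is the number of its
conjugates. -/
theorem natDegree_minpoly_eq_ncard_orbit [Normal M Ω] {x : Ω} (hx : (minpoly M x).Separable) :
    (minpoly M x).natDegree = (Set.range fun γ : Gal(Ω/M) => γ x).ncard := by
  have hint := Normal.isIntegral (F := M) ‹_› x
  rw [← card_rootSet_eq_natDegree hx (Normal.splits ‹_› x), ← Nat.card_eq_fintype_card,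
    Nat.card_coe_set_eq]
  congr 1
  ext y
  rw [mem_rootSet]
  constructor
  · rintro ⟨-, hy⟩
    have := minpoly.eq_of_irreducible_of_monic (minpoly.irreducible hint) hy (minpoly.monic hint)
    exact (Normal.minpoly_eq_iff_mem_orbit Ω).1 this.symm
  · rintro ⟨γ, rfl⟩
    refine ⟨minpoly.ne_zero hint, ?_⟩
    change aeval (γ x) _ = 0
    rw [← AlgEquiv.coe_toAlgHom, aeval_algHom_apply, minpoly.aeval, map_zero]

end GaloisAction

/-! ### Degrees of composita and intersections -/

open IntermediateField Module in
theorem finrank_inf_mul_finrank_sup {F E : Type*} [Field F] [Field E] [Algebra F E]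
    (A B : IntermediateField F E) [IsGalois F A] [FiniteDimensional F A] [FiniteDimensional F B] :
    finrank F ↥(A ⊓ B) * finrank F ↥(A ⊔ B) = finrank F A * finrank F B := by
  let K := A ⊓ B
  have hA : K ≤ A := inf_le_left
  have hB : K ≤ B := inf_le_right
  let A' := extendScalars hA
  let B' := extendScalars hB
  have i1 : IsGalois F A' := inferInstanceAs (IsGalois F A)
  have i2 : FiniteDimensional F A' := inferInstanceAs (FiniteDimensional F A)
  have i3 : FiniteDimensional F B' := inferInstanceAs (FiniteDimensional F B)
  have i4 : IsGalois K A' := IsGalois.tower_top_of_isGalois F K A'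
  have i5 : FiniteDimensional K A' := FiniteDimensional.right F K A'
  have i6 : FiniteDimensional K B' := FiniteDimensional.right F K B'
  have hld : A'.LinearDisjoint B' :=
    LinearDisjoint.of_inf_eq_bot (by rw [extendScalars_inf hA hB]; exact extendScalars_self K)
  have h := hld.finrank_sup
  rw [extendScalars_sup hA hB, ← relfinrank_eq_finrank_of_le, ← relfinrank_eq_finrank_of_le hA,
    ← relfinrank_eq_finrank_of_le hB] at h
  rw [← finrank_bot_mul_relfinrank hA, ← finrank_bot_mul_relfinrank hB,
    ← finrank_bot_mul_relfinrank (hA.trans (le_sup_left (b := B))), h]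
  ring

/-! ### Galois groups, decomposition type and fields -/

section Iso

variable {G₁ G₂ G₃ G₄ : Type*} [Group G₁] [Group G₂] [Group G₃] [Group G₄]

theorem Iso.symm (h : Iso G₁ G₂) : Iso G₂ G₁ := h.map MulEquiv.symm

theorem Iso.trans (h : Iso G₁ G₂) (h' : Iso G₂ G₃) : Iso G₁ G₃ :=
  h.elim fun e => h'.map e.trans

theorem Iso.prod (h : Iso G₁ G₂) (h' : Iso G₃ G₄) : Iso (G₁ × G₃) (G₂ × G₄) :=
  h.elim fun e => h'.map e.prodCongr

theorem Iso.card_eq (h : Iso G₁ G₂) : Nat.card G₁ = Nat.card G₂ :=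
  h.elim fun e => Nat.card_congr e.toEquiv

theorem iso_cyc_of_prime_card {p : ℕ} (hp : p.Prime) (h : Nat.card G₁ = p) : Iso G₁ (Cyc p) := by
  have := Fact.mk hp
  exact ⟨mulEquivOfPrimeCardEq (p := p) h (by simp)⟩

end Iso

/-- The Galois groups of the two cubics and of their product are the projections of a subgroup `H`
of `S₃ × S₃` and `H` itself, and the roots of the sextic, one for each bijection `σ` of the roots,
are permuted by `(g, h) • σ = h σ g⁻¹`. -/
theorem exists_subgroup {M Ω : Type*} [Field M] [Field Ω] [Algebra M Ω] [IsAlgClosed Ω]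
    [Normal M Ω] (h3 : (3 : M) ≠ 0) {a b : M} (hab : a ≠ b) (ha : a * (4 * a + 27) ≠ 0)
    (hb : b * (4 * b + 27) ≠ 0) :
    (sextic a b).Separable ∧ ∃ H : Subgroup (S3 × S3),
      Iso (G a) (H.map (MonoidHom.fst S3 S3)) ∧ Iso (G b) (H.map (MonoidHom.snd S3 S3)) ∧
      Iso (GPair a b) H ∧ ((DT a b).bind fun d => Multiset.replicate d d) = orbitSizes H := by
  obtain ⟨θ, ρ, hθ, hθr, hρ⟩ := exists_rootTriple (Ω := Ω) ha
  obtain ⟨η, ρ', hη, hηr, hρ'⟩ := exists_rootTriple (Ω := Ω) hb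
  have h3' : (3 : Ω) ≠ 0 := by
    have := (map_ne_zero (algebraMap M Ω)).2 h3
    rwa [map_ofNat] at this
  have hab' : algebraMap M Ω a ≠ algebraMap M Ω b := (algebraMap M Ω).injective.ne hab
  have ha' : algebraMap M Ω a ≠ 0 := (_root_.map_ne_zero _).2 (left_ne_zero_of_mul ha)
  have hb' : algebraMap M Ω b ≠ 0 := (_root_.map_ne_zero _).2 (left_ne_zero_of_mul hb)
  choose c hc using exists_isParameter h3' hab' hb' hθ hη
  have hinj : Function.Injective c := fun σ τ h =>
    IsParameter.perm_unique h3' hb' hη (hc σ) (h ▸ hc τ)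
  have hroots : (sextic a b).aroots Ω = (Finset.univ : Finset S3).val.map c := by
    rw [aroots_def, map_sextic]
    exact roots_sextic h3' hab' ha' hb' hθ hη hc
  have hne : sextic a b ≠ 0 :=
    ne_zero_of_natDegree_gt (n := 0) (by rw [natDegree_sextic hab]; simp)
  have hsep : (sextic a b).Separable := by
    rw [← separable_map (algebraMap M Ω), ← nodup_roots_iff_of_splits
      (Polynomial.map_ne_zero hne) (IsAlgClosed.splits _), ← aroots_def, hroots]
    exact Finset.univ.nodup.map hinj
  have hact : ∀ (γ : Gal(Ω/M)) σ, γ (c σ) = c (ρ' γ * σ * (ρ γ)⁻¹) := by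
    intro γ σ
    refine IsParameter.unique h3' hθ hη (σ := ρ' γ * σ * (ρ γ)⁻¹) ?_ (hc _)
    obtain ⟨l, m, h⟩ := hc σ
    refine ⟨γ l, γ m, fun i => ?_⟩
    have := congrArg γ (h ((ρ γ)⁻¹ i))
    simpa [hρ, hρ', map_ofNat γ] using this
  let P := ρ.prod ρ'
  refine ⟨hsep, P.range, ?_, ?_, ?_, ?_⟩
  · rw [MonoidHom.map_range]
    exact iso_gal_range _ (eq_one_iff_of_action hθ.injective hθr hρ)
  · rw [MonoidHom.map_range]
    exact iso_gal_range _ (eq_one_iff_of_action hη.injective hηr hρ')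
  · refine iso_gal_range P fun γ => ?_
    have hP : P γ = 1 ↔ ρ γ = 1 ∧ ρ' γ = 1 := Prod.ext_iff
    have hprod : cubic a * cubic b ≠ 0 :=
      mul_ne_zero (separable_cubic ha).ne_zero (separable_cubic hb).ne_zero
    rw [hP, eq_one_iff_of_action hθ.injective hθr hρ, eq_one_iff_of_action hη.injective hηr hρ']
    have hmem : ∀ x, x ∈ (cubic a * cubic b).rootSet Ω ↔
        x ∈ (cubic a).rootSet Ω ∨ x ∈ (cubic b).rootSet Ω := by
      intro x
      simp only [mem_rootSet, map_mul, mul_eq_zero, hprod, (separable_cubic ha).ne_zero,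
        (separable_cubic hb).ne_zero, ne_eq, not_false_eq_true, true_and]
    simp only [hmem, or_imp, forall_and]
  · rw [← map_natDegree_minpoly_aroots (Ω := Ω) hne, hroots, Multiset.map_map]
    refine Multiset.map_congr rfl fun σ _ => ?_
    have hroot : aeval (c σ) (sextic a b) = 0 := by
      have : c σ ∈ (sextic a b).aroots Ω := by
        rw [hroots]
        exact Multiset.mem_map_of_mem _ (Finset.mem_univ σ)
      exact (mem_aroots.1 this).2
    rw [Function.comp_apply, natDegree_minpoly_eq_ncard_orbit
      (hsep.of_dvd (minpoly.dvd M _ hroot)), ← Nat.card_coe_set_eq]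
    have himage : (Set.range fun γ : Gal(Ω/M) => γ (c σ)) =
        c '' {τ | ∃ x ∈ P.range, x.2 * σ * x.1⁻¹ = τ} := by
      ext y
      constructor
      · rintro ⟨γ, rfl⟩
        exact ⟨_, ⟨_, ⟨γ, rfl⟩, rfl⟩, (hact γ σ).symm⟩
      · rintro ⟨_, ⟨_, ⟨γ, rfl⟩, rfl⟩, rfl⟩
        exact ⟨γ, hact γ σ⟩
    rw [himage, Nat.card_image_of_injective hinj]
    rfl

section Fields

variable {M Ω : Type*} [Field M] [Field Ω] [Algebra M Ω]

theorem splittingFieldIn_spec [IsAlgClosed Ω] {f : M[X]} (hf : f.Separable) :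
    FiniteDimensional M (splittingFieldIn Ω f) ∧ IsGalois M (splittingFieldIn Ω f) ∧
      Module.finrank M (splittingFieldIn Ω f) = Nat.card f.Gal := by
  have hs : IsSplittingField M (splittingFieldIn Ω f) f :=
    IntermediateField.adjoin_rootSet_isSplittingField (IsAlgClosed.splits _)
  refine ⟨IsSplittingField.finiteDimensional _ f, IsGalois.of_separable_splitting_field hf, ?_⟩
  rw [Gal.card_of_separable hf]
  exact (IsSplittingField.algEquiv (splittingFieldIn Ω f) f).toLinearEquiv.finrank_eq

theorem splittingFieldIn_mul {f g : M[X]} (h : f * g ≠ 0) :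
    splittingFieldIn Ω (f * g) = splittingFieldIn Ω f ⊔ splittingFieldIn Ω g := by
  classical
  rw [splittingFieldIn, splittingFieldIn, splittingFieldIn, ← IntermediateField.adjoin_union,
    rootSet_def, rootSet_def, rootSet_def, aroots_mul h, Multiset.toFinset_add, Finset.coe_union]

/-- The position of `L_a` and `L_b` in terms of the orders of the three Galois groups. -/
theorem fields_of_card [IsAlgClosed Ω] {a b : M} (hab : a ≠ b) (ha : a * (4 * a + 27) ≠ 0)
    (hb : b * (4 * b + 27) ≠ 0) :
    Module.finrank M ↥(L Ω a ⊓ L Ω b) * Nat.card (GPair a b) = Nat.card (G a) * Nat.card (G b) ∧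
    (L Ω b ≤ L Ω a ↔ Nat.card (GPair a b) = Nat.card (G a)) ∧
    (L Ω a ≤ L Ω b ↔ Nat.card (GPair a b) = Nat.card (G b)) := by
  have sa := separable_cubic ha
  have sb := separable_cubic hb
  obtain ⟨fa, ga, ca⟩ := splittingFieldIn_spec (Ω := Ω) sa
  obtain ⟨fb, gb, cb⟩ := splittingFieldIn_spec (Ω := Ω) sb
  obtain ⟨fc, gc, cc⟩ := splittingFieldIn_spec (Ω := Ω) (sa.mul sb (isCoprime_cubic hab))
  rw [splittingFieldIn_mul (mul_ne_zero sa.ne_zero sb.ne_zero)] at fc cc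
  refine ⟨?_, ?_, ?_⟩
  · rw [← ca, ← cb, ← cc]
    exact finrank_inf_mul_finrank_sup _ _
  · rw [← ca, ← cc]
    constructor
    · intro h
      rw [sup_eq_left.2 h]
    · intro h
      exact sup_eq_left.1 (IntermediateField.eq_of_le_of_finrank_eq le_sup_left h.symm).symm
  · rw [← cb, ← cc]
    constructor
    · intro h
      rw [sup_eq_right.2 h]
    · intro h
      exact sup_eq_right.1 (IntermediateField.eq_of_le_of_finrank_eq le_sup_right h.symm).symm

end Fields

theorem card_values {A : Subgroup S3} (h : 1 < Nat.card A) :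
    Nat.card A = 2 ∨ Nat.card A = 3 ∨ Nat.card A = 6 := by
  have hd : Nat.card A ∈ Nat.divisors 6 := by
    rw [Nat.mem_divisors, ← card_S3]
    exact ⟨A.card_subgroup_dvd_card, by rw [card_S3]; norm_num⟩
  have : Nat.divisors 6 = {1, 2, 3, 6} := by decide
  rw [this] at hd
  simp only [Finset.mem_insert, Finset.mem_singleton] at hd
  omega

theorem tfae_three {p q r s : Prop} (hq : q ↔ p) (hr : r ↔ p) (hs : s ↔ p) :
    List.TFAE [q, r, s] := by
  rw [hq, hr, hs]
  exact fun x hx y hy => by simp_all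

theorem tfae_four {p q r s t : Prop} (hq : q ↔ p) (hr : r ↔ p) (hs : s ↔ p) (ht : t ↔ p) :
    List.TFAE [q, r, s, t] := by
  rw [hq, hr, hs, ht]
  exact fun x hx y hy => by simp_all

end CubicIntersection

theorem theorem5p1 {k M Ω : Type*} [Field k] [Field M] [Algebra k M] [Infinite M]
    [Field Ω] [Algebra M Ω] [IsAlgClosure M Ω]
    (hk2 : ringChar k ≠ 2) (hk3 : ringChar k ≠ 3) (a b : M) (hab : a ≠ b)
    (hdisc : a * b * (4 * a + 27) * (4 * b + 27) ≠ 0)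
    (hcard : Nat.card (G b) ≤ Nat.card (G a))
    (hb : 1 < Nat.card (G b)) :
    (sextic a b).Separable ∧
    ((Iso (G a) S3 ∧ Iso (G b) S3) ∨ (Iso (G a) S3 ∧ Iso (G b) (Cyc 3)) ∨ (Iso (G a) S3 ∧ Iso (G b) (Cyc 2)) ∨
      (Iso (G a) (Cyc 3) ∧ Iso (G b) (Cyc 3)) ∨ (Iso (G a) (Cyc 3) ∧ Iso (G b) (Cyc 2)) ∨
      (Iso (G a) (Cyc 2) ∧ Iso (G b) (Cyc 2))) ∧
    (Iso (G a) S3 → Iso (G b) S3 →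
      (DT a b = {6} ∨ DT a b = {3, 3} ∨ DT a b = {3, 2, 1}) ∧
      List.TFAE [DT a b = {6}, Iso (GPair a b) (S3 × S3), L Ω a ⊓ L Ω b = ⊥] ∧
      List.TFAE [DT a b = {3, 3}, Iso (GPair a b) C3C3C2, Module.finrank M ↥(L Ω a ⊓ L Ω b) = 2] ∧
      List.TFAE [DT a b = {3, 2, 1}, Iso (GPair a b) S3, L Ω a = L Ω b]) ∧
    (Iso (G a) S3 → Iso (G b) (Cyc 3) →
      DT a b = {6} ∧ Iso (GPair a b) (S3 × Cyc 3) ∧ L Ω a ⊓ L Ω b = ⊥) ∧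
    (Iso (G a) S3 → Iso (G b) (Cyc 2) →
      (DT a b = {6} ∨ DT a b = {3, 3}) ∧
      List.TFAE [DT a b = {6}, Iso (GPair a b) (DihedralGroup 6), ¬ L Ω b ≤ L Ω a, L Ω a ⊓ L Ω b = ⊥] ∧
      List.TFAE [DT a b = {3, 3}, Iso (GPair a b) S3, L Ω b ≤ L Ω a]) ∧
    (Iso (G a) (Cyc 3) → Iso (G b) (Cyc 3) →
      (DT a b = {3, 3} ∨ DT a b = {3, 1, 1, 1}) ∧
      List.TFAE [DT a b = {3, 3}, Iso (GPair a b) (Cyc 3 × Cyc 3), L Ω a ≠ L Ω b, L Ω a ⊓ L Ω b = ⊥] ∧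
      List.TFAE [DT a b = {3, 1, 1, 1}, Iso (GPair a b) (Cyc 3), L Ω a = L Ω b]) ∧
    (Iso (G a) (Cyc 3) → Iso (G b) (Cyc 2) →
      DT a b = {6} ∧ Iso (GPair a b) (Cyc 6) ∧ L Ω a ⊓ L Ω b = ⊥) ∧
    (Iso (G a) (Cyc 2) → Iso (G b) (Cyc 2) →
      (DT a b = {4, 2} ∨ DT a b = {2, 2, 1, 1}) ∧
      List.TFAE [DT a b = {4, 2}, Iso (GPair a b) (Cyc 2 × Cyc 2), L Ω a ≠ L Ω b, L Ω a ⊓ L Ω b = ⊥] ∧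
      List.TFAE [DT a b = {2, 2, 1, 1}, Iso (GPair a b) (Cyc 2), L Ω a = L Ω b]) := by
  have : IsAlgClosed Ω := IsAlgClosure.isAlgClosed M
  have : Normal M Ω := IsAlgClosure.normal M Ω
  have h3 : (3 : M) ≠ 0 := by
    have h3k : (3 : k) ≠ 0 := by
      intro h
      have hd : ringChar k ∣ 3 := (ringChar.spec k 3).1 (by exact_mod_cast h)
      rcases (Nat.dvd_prime Nat.prime_three).1 hd with h1 | h1
      · exact CharP.ringChar_ne_one h1
      · exact hk3 h1
    have := (map_ne_zero (algebraMap k M)).2 h3k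
    rwa [map_ofNat] at this
  have hda : a * (4 * a + 27) ≠ 0 := fun h => hdisc (by linear_combination b * (4 * b + 27) * h)
  have hdb : b * (4 * b + 27) ≠ 0 := fun h => hdisc (by linear_combination a * (4 * a + 27) * h)
  obtain ⟨hsep, H, ia, ib, iab, hDT⟩ := exists_subgroup (Ω := Ω) h3 hab hda hdb
  obtain ⟨hinf, hba, hab'⟩ := fields_of_card (Ω := Ω) hab hda hdb
  have cS := card_S3
  have c2 : Nat.card (Cyc 2) = 2 := by simp
  have c3 : Nat.card (Cyc 3) = 3 := by simp
  have hbot : L Ω a ⊓ L Ω b = ⊥ ↔ Module.finrank M ↥(L Ω a ⊓ L Ω b) = 1 :=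
    IntermediateField.finrank_eq_one_iff.symm
  have heq : L Ω a = L Ω b ↔ L Ω a ≤ L Ω b ∧ L Ω b ≤ L Ω a := le_antisymm_iff
  -- The two extreme cases: `H` is the product of its projections, or projects isomorphically onto
  -- the first factor.
  have full : Nat.card H = Nat.card (G a) * Nat.card (G b) → Iso (GPair a b) (G a × G b) := by
    intro h
    rw [ia.card_eq, ib.card_eq] at h
    have e : Iso H (H.map (MonoidHom.fst S3 S3) × H.map (MonoidHom.snd S3 S3)) :=
      ⟨(MulEquiv.subgroupCongr (eq_prod_of_card h)).trans (Subgroup.prodEquiv _ _)⟩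
    exact (iab.trans e).trans (ia.prod ib).symm
  have graph : Nat.card H = Nat.card (G a) → Iso (GPair a b) (G a) := by
    intro h
    rw [ia.card_eq] at h
    exact (iab.trans (nonempty_mulEquiv_map_of_card_eq _ h)).trans ia.symm
  have card_of : ∀ {Q : Type} [Group Q], Iso (GPair a b) Q → Nat.card H = Nat.card Q :=
    fun i => iab.card_eq.symm.trans i.card_eq
  -- The orbit sizes list each part `d` of the decomposition type `d` times.
  have dt : ∀ {m n : Multiset ℕ}, orbitSizes H = n → 0 ∉ m →
      (m.bind fun d => Multiset.replicate d d) = n → DT a b = m := fun h h0 hm =>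
    eq_of_bind_replicate_eq (zero_notMem_decompositionType _) h0 (hDT.trans (h.trans hm.symm))
  rw [iab.card_eq] at hinf hba hab'
  refine ⟨hsep, ?_, ?_, ?_, ?_, ?_, ?_, ?_⟩
  · have ka := hb.trans_le hcard
    rw [ib.card_eq, ia.card_eq] at hcard
    rw [ia.card_eq] at ka
    rw [ib.card_eq] at hb
    have two : ∀ {Q : Type _} [Group Q] {A : Subgroup S3}, Iso Q A → Nat.card A = 2 →
      Iso Q (Cyc 2) := fun i h => i.trans (iso_cyc_of_prime_card Nat.prime_two h)
    have three : ∀ {Q : Type _} [Group Q] {A : Subgroup S3}, Iso Q A → Nat.card A = 3 →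
      Iso Q (Cyc 3) := fun i h => i.trans (iso_cyc_of_prime_card Nat.prime_three h)
    have six : ∀ {Q : Type _} [Group Q] {A : Subgroup S3}, Iso Q A → Nat.card A = 6 →
      Iso Q S3 := fun i h => i.trans (by rw [eq_top_of_card h]; exact ⟨Subgroup.topEquiv⟩)
    rcases card_values ka with h1 | h1 | h1 <;> rcases card_values hb with h2 | h2 | h2
    · exact Or.inr (Or.inr (Or.inr (Or.inr (Or.inr ⟨two ia h1, two ib h2⟩))))
    · omega
    · omega
    · exact Or.inr (Or.inr (Or.inr (Or.inr (Or.inl ⟨three ia h1, two ib h2⟩))))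
    · exact Or.inr (Or.inr (Or.inr (Or.inl ⟨three ia h1, three ib h2⟩)))
    · omega
    · exact Or.inr (Or.inr (Or.inl ⟨six ia h1, two ib h2⟩))
    · exact Or.inr (Or.inl ⟨six ia h1, three ib h2⟩)
    · exact Or.inl ⟨six ia h1, six ib h2⟩
  all_goals
    intro ha' hb'
    have na := ha'.card_eq
    have nb := hb'.card_eq
    have ma := ia.symm.card_eq.trans na
    have mb := ib.symm.card_eq.trans nb
    simp only [cS, c2, c3] at na nb ma mb
    rw [na, nb] at hinf
    rw [na] at hba
    rw [nb] at hab'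
    rw [na, nb] at full
    rw [na] at graph
  · have cls := classification_S3_S3 ma mb
    have hD : (Nat.card H = 36 ∧ DT a b = {6}) ∨ (Nat.card H = 18 ∧ DT a b = {3, 3}) ∨
        (Nat.card H = 6 ∧ DT a b = {3, 2, 1}) :=
      cls.imp (fun h => ⟨h.1, dt h.2 (by decide) (by decide)⟩) fun h =>
        h.imp (fun h => ⟨h.1, dt h.2.1 (by decide) (by decide)⟩)
          fun h => ⟨h.1, dt h.2 (by decide) (by decide)⟩
    have d1 : DT a b = {6} ↔ Nat.card H = 36 := by
      rcases hD with ⟨h, d⟩ | ⟨h, d⟩ | ⟨h, d⟩ <;> rw [h, d] <;> decide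
    have d2 : DT a b = {3, 3} ↔ Nat.card H = 18 := by
      rcases hD with ⟨h, d⟩ | ⟨h, d⟩ | ⟨h, d⟩ <;> rw [h, d] <;> decide
    have d3 : DT a b = {3, 2, 1} ↔ Nat.card H = 6 := by
      rcases hD with ⟨h, d⟩ | ⟨h, d⟩ | ⟨h, d⟩ <;> rw [h, d] <;> decide
    have i1 : Iso (GPair a b) (S3 × S3) ↔ Nat.card H = 36 :=
      ⟨fun i => (card_of i).trans (by rw [Nat.card_prod, cS]),
        fun h => (full h).trans (ha'.prod hb')⟩
    have i2 : Iso (GPair a b) C3C3C2 ↔ Nat.card H = 18 := by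
      refine ⟨fun i => (card_of i).trans ?_, fun h => ?_⟩
      · rw [Nat.card_congr SemidirectProduct.equivProd]
        simp
      · rcases cls with ⟨h', -⟩ | ⟨h', -, hP⟩ | ⟨h', -⟩
        · omega
        · exact iab.trans (iso_C3C3C2_of_mem_iff h hP)
        · omega
    have i3 : Iso (GPair a b) S3 ↔ Nat.card H = 6 :=
      ⟨fun i => (card_of i).trans cS, fun h => (graph h).trans ha'⟩
    have f1 : L Ω a ⊓ L Ω b = ⊥ ↔ Nat.card H = 36 := by
      rw [hbot]
      constructor <;> intro h <;> rw [h] at hinf <;> omega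
    have f2 : Module.finrank M ↥(L Ω a ⊓ L Ω b) = 2 ↔ Nat.card H = 18 := by
      constructor <;> intro h <;> rw [h] at hinf <;> omega
    have f3 : L Ω a = L Ω b ↔ Nat.card H = 6 := by rw [heq, hab', hba, and_self]
    exact ⟨hD.imp And.right (Or.imp And.right And.right), tfae_three d1 i1 f1,
      tfae_three d2 i2 f2, tfae_three d3 i3 f3⟩
  · obtain ⟨hH, ho⟩ := classification_S3_C3 ma mb
    rw [hH] at hinf
    exact ⟨dt ho (by decide) (by decide), (full hH).trans (ha'.prod hb'), hbot.2 (by omega)⟩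
  · have hD : (Nat.card H = 12 ∧ DT a b = {6}) ∨ (Nat.card H = 6 ∧ DT a b = {3, 3}) :=
      (classification_S3_C2 ma mb).imp (fun h => ⟨h.1, dt h.2 (by decide) (by decide)⟩)
        fun h => ⟨h.1, dt h.2 (by decide) (by decide)⟩
    have d1 : DT a b = {6} ↔ Nat.card H = 12 := by
      rcases hD with ⟨h, d⟩ | ⟨h, d⟩ <;> rw [h, d] <;> decide
    have d2 : DT a b = {3, 3} ↔ Nat.card H = 6 := by
      rcases hD with ⟨h, d⟩ | ⟨h, d⟩ <;> rw [h, d] <;> decide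
    have i1 : Iso (GPair a b) (DihedralGroup 6) ↔ Nat.card H = 12 :=
      ⟨fun i => (card_of i).trans DihedralGroup.nat_card,
        fun h => ((full h).trans (ha'.prod hb')).trans iso_S3_prod_C2⟩
    have i2 : Iso (GPair a b) S3 ↔ Nat.card H = 6 :=
      ⟨fun i => (card_of i).trans cS, fun h => (graph h).trans ha'⟩
    have f1 : L Ω a ⊓ L Ω b = ⊥ ↔ Nat.card H = 12 := by
      rw [hbot]
      constructor <;> intro h <;> rw [h] at hinf <;> omega
    have f1' : ¬ L Ω b ≤ L Ω a ↔ Nat.card H = 12 := by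
      rw [hba]
      rcases hD with ⟨h, -⟩ | ⟨h, -⟩ <;> rw [h] <;> decide
    exact ⟨hD.imp And.right And.right, tfae_four d1 i1 f1' f1, tfae_three d2 i2 hba⟩
  · have hD : (Nat.card H = 9 ∧ DT a b = {3, 3}) ∨ (Nat.card H = 3 ∧ DT a b = {3, 1, 1, 1}) :=
      (classification_C3_C3 ma mb).imp (fun h => ⟨h.1, dt h.2 (by decide) (by decide)⟩)
        fun h => ⟨h.1, dt h.2 (by decide) (by decide)⟩
    have d1 : DT a b = {3, 3} ↔ Nat.card H = 9 := by
      rcases hD with ⟨h, d⟩ | ⟨h, d⟩ <;> rw [h, d] <;> decide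
    have d2 : DT a b = {3, 1, 1, 1} ↔ Nat.card H = 3 := by
      rcases hD with ⟨h, d⟩ | ⟨h, d⟩ <;> rw [h, d] <;> decide
    have i1 : Iso (GPair a b) (Cyc 3 × Cyc 3) ↔ Nat.card H = 9 :=
      ⟨fun i => (card_of i).trans (by rw [Nat.card_prod, c3]),
        fun h => (full h).trans (ha'.prod hb')⟩
    have i2 : Iso (GPair a b) (Cyc 3) ↔ Nat.card H = 3 :=
      ⟨fun i => (card_of i).trans c3, fun h => (graph h).trans ha'⟩
    have f1 : L Ω a ⊓ L Ω b = ⊥ ↔ Nat.card H = 9 := by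
      rw [hbot]
      constructor <;> intro h <;> rw [h] at hinf <;> omega
    have f2 : L Ω a = L Ω b ↔ Nat.card H = 3 := by rw [heq, hab', hba, and_self]
    have f1' : L Ω a ≠ L Ω b ↔ Nat.card H = 9 := by
      rw [Ne, f2]
      rcases hD with ⟨h, -⟩ | ⟨h, -⟩ <;> rw [h] <;> decide
    exact ⟨hD.imp And.right And.right, tfae_four d1 i1 f1' f1, tfae_three d2 i2 f2⟩
  · obtain ⟨hH, ho⟩ := classification_C3_C2 ma mb
    rw [hH] at hinf
    exact ⟨dt ho (by decide) (by decide), ((full hH).trans (ha'.prod hb')).trans iso_C3_prod_C2,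
      hbot.2 (by omega)⟩
  · have hD : (Nat.card H = 4 ∧ DT a b = {4, 2}) ∨ (Nat.card H = 2 ∧ DT a b = {2, 2, 1, 1}) :=
      (classification_C2_C2 ma mb).imp (fun h => ⟨h.1, dt h.2 (by decide) (by decide)⟩)
        fun h => ⟨h.1, dt h.2 (by decide) (by decide)⟩
    have d1 : DT a b = {4, 2} ↔ Nat.card H = 4 := by
      rcases hD with ⟨h, d⟩ | ⟨h, d⟩ <;> rw [h, d] <;> decide
    have d2 : DT a b = {2, 2, 1, 1} ↔ Nat.card H = 2 := by
      rcases hD with ⟨h, d⟩ | ⟨h, d⟩ <;> rw [h, d] <;> decide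
    have i1 : Iso (GPair a b) (Cyc 2 × Cyc 2) ↔ Nat.card H = 4 :=
      ⟨fun i => (card_of i).trans (by rw [Nat.card_prod, c2]),
        fun h => (full h).trans (ha'.prod hb')⟩
    have i2 : Iso (GPair a b) (Cyc 2) ↔ Nat.card H = 2 :=
      ⟨fun i => (card_of i).trans c2, fun h => (graph h).trans ha'⟩
    have f1 : L Ω a ⊓ L Ω b = ⊥ ↔ Nat.card H = 4 := by
      rw [hbot]
      constructor <;> intro h <;> rw [h] at hinf <;> omega
    have f2 : L Ω a = L Ω b ↔ Nat.card H = 2 := by rw [heq, hab', hba, and_self]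
    have f1' : L Ω a ≠ L Ω b ↔ Nat.card H = 4 := by
      rw [Ne, f2]
      rcases hD with ⟨h, -⟩ | ⟨h, -⟩ <;> rw [h] <;> decide
    exact ⟨hD.imp And.right And.right, tfae_four d1 i1 f1' f1, tfae_three d2 i2 f2⟩
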